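/- Let $g\in C^\infty(\mathbb R,\mathbb R)$ with $g(0)=1$, let $0<\omega<1$, and let $\phi=(v,u)$ be real-valued, not identically zero, with $v,u\in H^1(\mathbb R)$ (taken as continuous representatives, which are classical solutions) and $$\omega v=\partial_x u+g(v^2-u^2)\,v,\qquad \omega u=-\partial_x v-g(v^2-u^2)\,u ,$$ so that $\phi(x)e^{-i\omega t}$ is a solitary wave of the nonlinear Dirac equation $i\partial_t\psi_1=\partial_x\psi_2+g(|\psi_1|^2-|\psi_2|^2)\psi_1$, $i\partial_t\psi_2=-\partial_x\psi_1-g(|\psi_1|^2-|\psi_2|^2)\psi_2$. With $g,g'$ evaluated at $v^2-u^2$, put $$\mathscr H_-=\begin{bmatrix} g-\omega&\partial_x\\-\partial_x&-g-\omega\end{bmatrix},\qquad \mathscr H_+=\begin{bmatrix}2g'v^2+g-\omega&\partial_x-2g'vu\\-\partial_x-2g'vu&2g'u^2-g-\omega\end{bmatrix},\qquad L_\omega=\begin{bmatrix}0&\mathscr H_-\\-\mathscr H_+&0\end{bmatrix},$$ where $L_\omega$ acts in $L^2(\mathbb R,\mathbb C^4)$ with domain $H^1(\mathbb R,\mathbb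 C^4)$. Then: 1. The continuous spectrum of $L_\omega$ is the pair of imaginary half-lines $\Sigma=\{\lambda\in i\mathbb R:\ |\operatorname{Im}\lambda|\ge 1-\omega\}=(-i\infty,-i(1-\omega)]\cup[i(1-\omega),+i\infty)$, where the continuous spectrum may contain embedded eigenvalues. Precisely: the essential spectrum, i.e. the set of $\lambda\in\mathbb C$ for which $L_\omega-\lambda$ is not Fredholm, equals $\Sigma$; and the set of $\lambda\in\mathbb C$ for which $L_\omega-\lambda$ is injective with dense range but not onto equals $\Sigma$ with the eigenvalues of $L_\omega$ removed. 2. $\ker L_\omega$ is the complex linear span of $\begin{bmatrix}\partial_x\phi\\0\end{bmatrix}$ and $\begin{bmatrix}0\\\phi\end{bmatrix}$. 3. $\pm2i\omega$ are eigenvalues of $L_\omega$: with $\varphi=(u,v)$, the vectors $\begin{bmatrix}\varphi\\\pm i\varphi\end{bmatrix}$ are nonzero elements of the domain and $L_\omega\begin{bmatrix}\varphi\\\pm i\varphi\end{bmatrix}=\mp2i\omega\begin{bmatrix}\varphi\\\pm i\varphi\end{bmatrix}$. -/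

import Mathlib

open MeasureTheory
open scoped ENNReal

/-! ### Spectral notions for unbounded operators -/

namespace LinearPMap

variable {E : Type*} [NormedAddCommGroup E] [NormedSpace ℂ E]

/-- `T - z` as a linear map from the domain of `T`. -/
def subScalar (T : E →ₗ.[ℂ] E) (z : ℂ) : T.domain →ₗ[ℂ] E :=
  T.toFun - z • T.domain.subtype

/-- `T - z` as a bounded operator on the domain of `T` with its graph norm
(the domain is represented by the graph of `T`, on which `T - z` is `(f, T f) ↦ T f - z f`). -/
noncomputable def subScalarGraph (T : E →ₗ.[ℂ] E) (z : ℂ) : T.graph →L[ℂ] E :=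
  (ContinuousLinearMap.snd ℂ E E - z • ContinuousLinearMap.fst ℂ E E).comp T.graph.subtypeL

/-- `f` is an eigenvector of `T` with eigenvalue `z`. -/
def IsEigenvector (T : E →ₗ.[ℂ] E) (z : ℂ) (f : E) : Prop :=
  f ≠ 0 ∧ ∃ hf : f ∈ T.domain, T ⟨f, hf⟩ = z • f

/-- The set of eigenvalues of `T`. -/
def pointSpectrum (T : E →ₗ.[ℂ] E) : Set ℂ :=
  {z | ∃ f, T.IsEigenvector z f}

/-- The essential spectrum: all `z` for which `T - z` is not a Fredholm operator. -/
def essentialSpectrum (T : E →ₗ.[ℂ] E) : Set ℂ :=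
  {z | ¬ (T.subScalarGraph z).IsFredholm}

/-- The continuous spectrum in the narrow sense (disjoint from the eigenvalues): all `z` for
which `T - z` is injective with dense range, but not onto. -/
def continuousSpectrum (T : E →ₗ.[ℂ] E) : Set ℂ :=
  {z | Function.Injective (T.subScalar z) ∧ DenseRange (T.subScalar z) ∧
    ¬ Function.Surjective (T.subScalar z)}

/-- The null space of `T`, as a subspace of `E`. -/
def nullSpace (T : E →ₗ.[ℂ] E) : Submodule ℂ E :=
  (LinearMap.ker T.toFun).map T.domain.subtype

end LinearPMap

namespace NLDirac

/-! ### `L²(ℝ, ℂ²)`, differentiation and matrix multiplication -/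

/-- `L²(ℝ, ℂ²)`. -/
abbrev L2C2 : Type := Lp (EuclideanSpace ℂ (Fin 2)) 2 (volume : Measure ℝ)

/-- `h` is the distributional derivative of `f`. -/
def IsWeakDeriv (f h : L2C2) : Prop :=
  TemperedDistribution.derivCLM _ (Lp.toTemperedDistributionCLM _ volume 2 f)
    = Lp.toTemperedDistributionCLM _ volume 2 h

theorem IsWeakDeriv.unique {f h k : L2C2} (h1 : IsWeakDeriv f h) (h2 : IsWeakDeriv f k) :
    h = k :=
  LinearMap.ker_eq_bot.mp
    (Lp.ker_toTemperedDistributionCLM_eq_bot (F := EuclideanSpace ℂ (Fin 2))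
      (μ := (volume : Measure ℝ)) (p := 2)) (h1.symm.trans h2)

theorem IsWeakDeriv.add {f h f' h' : L2C2} (h1 : IsWeakDeriv f h) (h2 : IsWeakDeriv f' h') :
    IsWeakDeriv (f + f') (h + h') := by
  unfold IsWeakDeriv at *
  rw [map_add, map_add, map_add, h1, h2]

theorem IsWeakDeriv.smul {f h : L2C2} (c : ℂ) (h1 : IsWeakDeriv f h) :
    IsWeakDeriv (c • f) (c • h) := by
  unfold IsWeakDeriv at *
  rw [map_smul, map_smul, map_smul, h1]

/-- The operator `∂_x` in `L²(ℝ, ℂ²)`; its domain is the Sobolev space `H¹(ℝ, ℂ²)`. -/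
noncomputable def dx : L2C2 →ₗ.[ℂ] L2C2 where
  domain :=
    { carrier := {f | ∃ h, IsWeakDeriv f h}
      add_mem' := fun ⟨h, hh⟩ ⟨k, hk⟩ => ⟨h + k, hh.add hk⟩
      zero_mem' := ⟨0, by unfold IsWeakDeriv; rw [map_zero, map_zero]⟩
      smul_mem' := fun c _ ⟨h, hh⟩ => ⟨c • h, hh.smul c⟩ }
  toFun :=
    { toFun := fun f => f.2.choose
      map_add' := fun f k =>
        (f + k).2.choose_spec.unique (f.2.choose_spec.add k.2.choose_spec)
      map_smul' := fun c f => (c • f).2.choose_spec.unique (f.2.choose_spec.smul c) }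

/-- Pointwise multiplication of a function by a matrix-valued function. -/
noncomputable def matMul (M : ℝ → Matrix (Fin 2) (Fin 2) ℂ) (f : ℝ → EuclideanSpace ℂ (Fin 2)) :
    ℝ → EuclideanSpace ℂ (Fin 2) :=
  fun x => Matrix.toEuclideanCLM (𝕜 := ℂ) (M x) (f x)

theorem matMul_add_ae (M : ℝ → Matrix (Fin 2) (Fin 2) ℂ) (f k : L2C2) :
    matMul M (f + k : L2C2) =ᵐ[volume] matMul M f + matMul M k := by
  filter_upwards [Lp.coeFn_add f k] with x hx
  simp only [matMul, Pi.add_apply, hx, map_add]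

theorem matMul_smul_ae (M : ℝ → Matrix (Fin 2) (Fin 2) ℂ) (c : ℂ) (f : L2C2) :
    matMul M (c • f : L2C2) =ᵐ[volume] c • matMul M f := by
  filter_upwards [Lp.coeFn_smul c f] with x hx
  simp only [matMul, Pi.smul_apply, hx, map_smul]

theorem matMul_zero_ae (M : ℝ → Matrix (Fin 2) (Fin 2) ℂ) :
    matMul M (0 : L2C2) =ᵐ[volume] 0 := by
  filter_upwards [Lp.coeFn_zero (EuclideanSpace ℂ (Fin 2)) 2 (volume : Measure ℝ)] with x hx
  simp only [matMul, hx, Pi.zero_apply, map_zero]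

/-- The operator of multiplication by `M` in `L²(ℝ, ℂ²)`, on the domain of all `f ∈ L²` with
`M f ∈ L²`; this is all of `L²` for measurable and bounded `M`. -/
noncomputable def mulOp (M : ℝ → Matrix (Fin 2) (Fin 2) ℂ) : L2C2 →ₗ.[ℂ] L2C2 where
  domain :=
    { carrier := {f | MemLp (matMul M f) 2 volume}
      add_mem' := fun {f k} hf hk => (memLp_congr_ae (matMul_add_ae M f k)).mpr (hf.add hk)
      zero_mem' := (memLp_congr_ae (matMul_zero_ae M)).mpr MemLp.zero
      smul_mem' := fun c f hf =>
        (memLp_congr_ae (matMul_smul_ae M c f)).mpr (MemLp.const_smul hf c) }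
  toFun :=
    { toFun := fun f => MemLp.toLp (matMul M f.1) f.2
      map_add' := fun f k => by
        rw [← MemLp.toLp_add f.2 k.2]
        exact MemLp.toLp_congr _ _ (matMul_add_ae M f.1 k.1)
      map_smul' := fun c f => by
        rw [RingHom.id_apply, ← MemLp.toLp_const_smul c f.2]
        exact MemLp.toLp_congr _ _ (matMul_smul_ae M c f.1) }

/-- The one-dimensional Dirac operator `[[0, ∂_x], [-∂_x, 0]] + M(x)` in `L²(ℝ, ℂ²)`.
For measurable and bounded `M` its domain is `H¹(ℝ, ℂ²)`. -/
noncomputable def diracOp (M : ℝ → Matrix (Fin 2) (Fin 2) ℂ) : L2C2 →ₗ.[ℂ] L2C2 :=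
  ((Matrix.toEuclideanCLM (𝕜 := ℂ) (n := Fin 2) !![0, 1; -1, 0]).compLpL 2
    (volume : Measure ℝ)).toLinearMap.compPMap dx + mulOp M

/-! ### Solitary waves and the linearization -/

/-- `(v, u)` is the real-valued profile of a nonzero solitary wave `(v(x), u(x)) e^{-iωt}`, with
`v, u ∈ H¹(ℝ)`, of the nonlinear Dirac equation
`i ∂_t ψ₁ = ∂_x ψ₂ + g(|ψ₁|² - |ψ₂|²) ψ₁`, `i ∂_t ψ₂ = -∂_x ψ₁ - g(|ψ₁|² - |ψ₂|²) ψ₂`.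
An `H¹` solution is identified with its continuous representative, which is a classical
solution. -/
structure IsSolitaryWave (g : ℝ → ℝ) (ω : ℝ) (v u : ℝ → ℝ) : Prop where
  differentiable_v : Differentiable ℝ v
  differentiable_u : Differentiable ℝ u
  memLp_v : MemLp v 2 volume
  memLp_u : MemLp u 2 volume
  memLp_deriv_v : MemLp (deriv v) 2 volume
  memLp_deriv_u : MemLp (deriv u) 2 volume
  eq_v : ∀ x, ω * v x = deriv u x + g (v x ^ 2 - u x ^ 2) * v x
  eq_u : ∀ x, ω * u x = -deriv v x - g (v x ^ 2 - u x ^ 2) * u x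
  ne_zero : ∃ x, v x ≠ 0 ∨ u x ≠ 0

/-- The zeroth-order part of `ℋ₋`, where `g` is evaluated at `v² - u²`. -/
def potMinus (g : ℝ → ℝ) (ω : ℝ) (v u : ℝ → ℝ) (x : ℝ) : Matrix (Fin 2) (Fin 2) ℂ :=
  (!![g (v x ^ 2 - u x ^ 2) - ω, 0;
      0, -g (v x ^ 2 - u x ^ 2) - ω] : Matrix (Fin 2) (Fin 2) ℝ).map Complex.ofReal

/-- The zeroth-order part of `ℋ₊`, where `g` and `g'` are evaluated at `v² - u²`. -/
noncomputable def potPlus (g : ℝ → ℝ) (ω : ℝ) (v u : ℝ → ℝ) (x : ℝ) :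
    Matrix (Fin 2) (Fin 2) ℂ :=
  (!![2 * deriv g (v x ^ 2 - u x ^ 2) * v x ^ 2 + g (v x ^ 2 - u x ^ 2) - ω,
        -(2 * deriv g (v x ^ 2 - u x ^ 2) * v x * u x);
      -(2 * deriv g (v x ^ 2 - u x ^ 2) * v x * u x),
        2 * deriv g (v x ^ 2 - u x ^ 2) * u x ^ 2 - g (v x ^ 2 - u x ^ 2) - ω] :
    Matrix (Fin 2) (Fin 2) ℝ).map Complex.ofReal

/-- `ℋ₋ = [[g - ω, ∂_x], [-∂_x, -g - ω]]`. -/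
noncomputable def Hminus (g : ℝ → ℝ) (ω : ℝ) (v u : ℝ → ℝ) : L2C2 →ₗ.[ℂ] L2C2 :=
  diracOp (potMinus g ω v u)

/-- `ℋ₊ = [[2g'v² + g - ω, ∂_x - 2g'vu], [-∂_x - 2g'vu, 2g'u² - g - ω]]`. -/
noncomputable def Hplus (g : ℝ → ℝ) (ω : ℝ) (v u : ℝ → ℝ) : L2C2 →ₗ.[ℂ] L2C2 :=
  diracOp (potPlus g ω v u)

/-- `L²(ℝ, ℂ⁴) = L²(ℝ, ℂ²) ⊕ L²(ℝ, ℂ²)`, with elements `(ρ, ς)`. -/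
abbrev L2C4 : Type := WithLp 2 (L2C2 × L2C2)

/-- The block operator `[[0, A], [-B, 0]]`, that is `(ρ, ς) ↦ (A ς, -B ρ)`. -/
noncomputable def blockOp (A B : L2C2 →ₗ.[ℂ] L2C2) : L2C4 →ₗ.[ℂ] L2C4 where
  domain :=
    { carrier := {f | f.fst ∈ B.domain ∧ f.snd ∈ A.domain}
      add_mem' := fun hf hk => ⟨B.domain.add_mem hf.1 hk.1, A.domain.add_mem hf.2 hk.2⟩
      zero_mem' := ⟨B.domain.zero_mem, A.domain.zero_mem⟩
      smul_mem' := fun c _ hf => ⟨B.domain.smul_mem c hf.1, A.domain.smul_mem c hf.2⟩ }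
  toFun :=
    { toFun := fun f => WithLp.toLp 2 (A ⟨f.1.snd, f.2.2⟩, -B ⟨f.1.fst, f.2.1⟩)
      map_add' := fun f k => WithLp.ofLp_injective 2 (Prod.ext
        (A.map_add ⟨f.1.snd, f.2.2⟩ ⟨k.1.snd, k.2.2⟩)
        ((congrArg Neg.neg (B.map_add ⟨f.1.fst, f.2.1⟩ ⟨k.1.fst, k.2.1⟩)).trans (neg_add _ _)))
      map_smul' := fun c f => WithLp.ofLp_injective 2 (Prod.ext
        (A.map_smul c ⟨f.1.snd, f.2.2⟩)
        ((congrArg Neg.neg (B.map_smul c ⟨f.1.fst, f.2.1⟩)).trans (smul_neg c _).symm)) }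

/-- The linearization `L_ω = [[0, ℋ₋], [-ℋ₊, 0]]` at the solitary wave, with domain
`H¹(ℝ, ℂ⁴)`. -/
noncomputable def linOp (g : ℝ → ℝ) (ω : ℝ) (v u : ℝ → ℝ) : L2C4 →ₗ.[ℂ] L2C4 :=
  blockOp (Hminus g ω v u) (Hplus g ω v u)

theorem memLp_spinor {a b : ℝ → ℝ} (ha : MemLp a 2 volume) (hb : MemLp b 2 volume) :
    MemLp (fun x => (!₂[(a x : ℂ), (b x : ℂ)] : EuclideanSpace ℂ (Fin 2))) 2 volume := by
  refine MemLp.of_eval_piLp fun i => ?_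
  fin_cases i
  · simpa using ha.ofReal (K := ℂ)
  · simpa using hb.ofReal (K := ℂ)

/-- The element `(a, b)` of `L²(ℝ, ℂ²)` for real-valued `a, b ∈ L²(ℝ)`. -/
noncomputable def spinor {a b : ℝ → ℝ} (ha : MemLp a 2 volume) (hb : MemLp b 2 volume) : L2C2 :=
  (memLp_spinor ha hb).toLp _

end NLDirac

/-!
The linearization has the form `L = [[0, ℋ₋], [-ℋ₊, 0]]`, where `ℋ₋` and `ℋ₊` are self-adjoint
one-dimensional Dirac operators `J ∂_x + M(x)` with `J = [[0, 1], [-1, 0]]`.  An `H¹` profile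
vanishes at infinity and `g 0 = 1`, so both potentials tend to the constant
`limitPot ω = diag(1 - ω, -1 - ω)`.

*Essential spectrum.*  Since `J ∂_x` and `β = diag(1, -1)` anticommute, the free operator
`J ∂_x + β - ω` has the spectral gap `(-(1 - ω), 1 - ω)` (`freeOp_gap`); hence the free block
operator, which is skew-adjoint, is invertible outside the two half-lines `Σ`
(`bijective_subScalarGraph_blockOp`).  Multiplication by a potential decaying at infinity is
relatively compact: `H¹` embeds into the Hölder functions of exponent `1/2`, and this yields
explicit approximations of finite rank (`mulCLM_comp_mem_closure_finiteRank`).  So `L - z` is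
Fredholm for `z ∉ Σ` (`isFredholm_blockOp`).  For `z ∈ Σ`, plane waves of the free operator, cut
off on disjoint intervals escaping to infinity, are orthogonal approximate eigenvectors, which is
incompatible with a quasi-inverse (`not_isFredholm_blockOp`).

*Continuous spectrum.*  Exchanging the two components conjugates `L` to its adjoint, and changing
the sign of one component conjugates `L` to `-L`.  For `z ∈ iℝ` these symmetries turn a vector
orthogonal to the range of `L - z` into an eigenvector for `z`, so that `L - z` has dense range
unless `z` is an eigenvalue (`denseRange_blockOp`).

*Kernel.*  Two `L²` solutions of the system `J f' + M f = 0` with symmetric `M` have a Wronskian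
which is both constant and integrable, hence zero; so they are proportional
(`eq_smul_of_mem_graph_zero`).  The solitary wave `φ` is such a solution for `ℋ₋`, and its
derivative, which does not vanish identically, is one for `ℋ₊`.

*The eigenvalues `±2iω`.*  The vector `(u, v)` is an eigenvector of both `ℋ₋` and `ℋ₊` with
eigenvalue `-2ω` (`IsSolitaryWave.isEigenvector_linOp`).

Unbounded operators are handled through their graphs throughout.
-/


namespace NLDirac
open Filter Topology ComplexConjugate
open scoped SchwartzMap LineDeriv FourierTransform

/-! ### Weak derivatives in `L²(ℝ, ℂ²)` -/

/-- The fibre `ℂ²`. -/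
abbrev Spin : Type := EuclideanSpace ℂ (Fin 2)

/-- The `ℝ`-linear map `z ↦ conj z • w`. -/
noncomputable def conjSmul (w : Spin) : ℂ →L[ℝ] Spin :=
  ((ContinuousLinearMap.toSpanSingleton ℂ w).restrictScalars ℝ).comp
    (Complex.conjCLE : ℂ →L[ℝ] ℂ)

theorem conjSmul_apply (w : Spin) (z : ℂ) : conjSmul w z = conj z • w := by
  simp [conjSmul]

/-- The vector-valued Schwartz function `conj η • w`, which turns the pairing with `η` of a
distribution defined by an `L²` function into an `L²` inner product. -/
noncomputable def conjTest (η : 𝓢(ℝ, ℂ)) (w : Spin) : 𝓢(ℝ, Spin) :=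
  η.postcompCLM (conjSmul w)

theorem conjTest_apply (η : 𝓢(ℝ, ℂ)) (w : Spin) (x : ℝ) :
    conjTest η w x = conj (η x) • w := by
  simp [conjTest, conjSmul_apply]

theorem deriv_conjTest (η : 𝓢(ℝ, ℂ)) (w : Spin) :
    SchwartzMap.derivCLM ℂ Spin (conjTest η w) = conjTest (SchwartzMap.derivCLM ℂ ℂ η) w := by
  ext1 x
  rw [SchwartzMap.derivCLM_apply, conjTest_apply, ← conjSmul_apply, SchwartzMap.derivCLM_apply]
  have := (conjSmul w).hasFDerivAt.comp_hasDerivAt x (η.hasDerivAt x)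
  refine (this.congr_of_eventuallyEq (Eventually.of_forall fun y => ?_)).deriv
  simp [conjTest_apply, conjSmul_apply]

theorem inner_toTemperedDistribution (f : L2C2) (η : 𝓢(ℝ, ℂ)) (w : Spin) :
    inner ℂ w (Lp.toTemperedDistributionCLM Spin volume 2 f η)
      = inner ℂ ((conjTest η w).toLp 2 volume) f := by
  rw [Lp.toTemperedDistributionCLM_apply, Lp.toTemperedDistribution_apply, L2.inner_def,
    ← integral_inner]
  · refine integral_congr_ae ?_
    filter_upwards [(conjTest η w).coeFn_toLp 2 volume] with x hx
    rw [hx, conjTest_apply, inner_smul_left, inner_smul_right]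
    simp
  · exact memLp_one_iff_integrable.mp ((Lp.memLp f).smul (η.memLp 2 volume))

/-- A pair of `L²` functions satisfying the integration by parts formula against all Schwartz
functions consists of a function and its distributional derivative. -/
theorem IsWeakDeriv.of_forall_inner {f h : L2C2}
    (H : ∀ ψ : 𝓢(ℝ, Spin), inner ℂ ((SchwartzMap.derivCLM ℂ Spin ψ).toLp 2 volume) f
      = - inner ℂ (ψ.toLp 2 volume) h) : IsWeakDeriv f h := by
  unfold IsWeakDeriv
  ext1 η
  refine ext_inner_left ℂ fun w => ?_
  rw [TemperedDistribution.derivCLM_apply_apply, map_neg, inner_neg_right,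
    inner_toTemperedDistribution, inner_toTemperedDistribution, ← deriv_conjTest, H, neg_neg]

theorem isWeakDeriv_toLp (ψ : 𝓢(ℝ, Spin)) :
    IsWeakDeriv (ψ.toLp 2 volume) ((SchwartzMap.derivCLM ℂ Spin ψ).toLp 2 volume) := by
  unfold IsWeakDeriv
  simp only [Lp.toTemperedDistributionCLM_apply, Lp.toTemperedDistribution_toLp_eq]
  exact TemperedDistribution.derivCLM_toTemperedDistributionCLM_eq ℂ ψ

theorem isClosed_isWeakDeriv : IsClosed {p : L2C2 × L2C2 | IsWeakDeriv p.1 p.2} := by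
  unfold IsWeakDeriv
  apply isClosed_eq <;> fun_prop

/-- A square integrable solution of `f'' = f` on the line vanishes: on the Fourier side,
`(1 + (2πξ)²) f̂ = 0`. -/
theorem eq_zero_of_isWeakDeriv_of_isWeakDeriv {f h : L2C2} (h1 : IsWeakDeriv f h)
    (h2 : IsWeakDeriv h f) : f = 0 := by
  set T := Lp.toTemperedDistributionCLM Spin (volume : Measure ℝ) 2 with hT
  have key : ∀ u : 𝓢'(ℝ, Spin), TemperedDistribution.derivCLM Spin u = ∂_{(1 : ℝ)} u := by
    intro u
    ext1 η
    rw [TemperedDistribution.derivCLM_apply_apply, TemperedDistribution.lineDerivOp_apply_apply]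
    congr 2
  have e : ∂_{(1 : ℝ)} (∂_{(1 : ℝ)} (T f)) = T f := by
    rw [← key, ← key]
    rw [show TemperedDistribution.derivCLM Spin (T f) = T h from h1]
    exact h2
  have e2 := congrArg (fun u => (𝓕 u : 𝓢'(ℝ, Spin))) e
  simp only [TemperedDistribution.fourier_lineDerivOp_eq, map_smul] at e2
  have hg : (fun x : ℝ => ((1 + ((2 * Real.pi) * x) ^ 2 : ℝ) : ℂ)).HasTemperateGrowth := by
    fun_prop
  -- The inverse of the symbol `1 + (2πξ)²` has temperate growth, so it may be multiplied with.
  have hg' : (fun x : ℝ =>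
      (((1 + ‖(2 * Real.pi) * x‖ ^ 2) ^ (-1 : ℝ) : ℝ) : ℂ)).HasTemperateGrowth := by
    have a := Function.hasTemperateGrowth_one_add_norm_sq_rpow ℝ (-1)
    have b : (fun x : ℝ => (2 * Real.pi) * x).HasTemperateGrowth := by fun_prop
    have c : (fun x : ℝ => (1 + ‖(2 * Real.pi) * x‖ ^ 2) ^ (-1 : ℝ)).HasTemperateGrowth :=
      a.comp b
    fun_prop
  have hx : (fun x : ℝ => ((inner ℝ x (1 : ℝ) : ℝ) : ℂ)).HasTemperateGrowth := by fun_prop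
  have e3 : TemperedDistribution.smulLeftCLM Spin
      (fun x : ℝ => ((1 + ((2 * Real.pi) * x) ^ 2 : ℝ) : ℂ)) (𝓕 (T f)) = 0 := by
    rw [TemperedDistribution.smulLeftCLM_smulLeftCLM_apply hx hx, smul_smul] at e2
    have : (fun x : ℝ => ((1 + ((2 * Real.pi) * x) ^ 2 : ℝ) : ℂ)) = (fun _ : ℝ => (1 : ℂ)) +
        (-((2 * Real.pi * Complex.I) * (2 * Real.pi * Complex.I))) •
        ((fun x : ℝ => ((inner ℝ x (1 : ℝ) : ℝ) : ℂ)) *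
          (fun x : ℝ => ((inner ℝ x (1 : ℝ) : ℝ) : ℂ))) := by
      ext x
      simp
      linear_combination (4 * (Real.pi : ℂ) ^ 2 * x ^ 2) * Complex.I_sq
    rw [this, TemperedDistribution.smulLeftCLM_add (by fun_prop) (by fun_prop),
      TemperedDistribution.smulLeftCLM_smul (by fun_prop), add_apply,
      smul_apply, neg_smul, e2, TemperedDistribution.smulLeftCLM_const]
    simp
  have e4 : (𝓕 (T f) : 𝓢'(ℝ, Spin)) = 0 := by
    have := congrArg (TemperedDistribution.smulLeftCLM Spin
      (fun x : ℝ => (((1 + ‖(2 * Real.pi) * x‖ ^ 2) ^ (-1 : ℝ) : ℝ) : ℂ))) e3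
    rw [TemperedDistribution.smulLeftCLM_smulLeftCLM_apply hg hg', map_zero] at this
    rw [← this]
    have e5 : (fun x : ℝ => ((1 + ((2 * Real.pi) * x) ^ 2 : ℝ) : ℂ)) *
        (fun x : ℝ => (((1 + ‖(2 * Real.pi) * x‖ ^ 2) ^ (-1 : ℝ) : ℝ) : ℂ)) = fun _ => 1 := by
      ext x
      have hp : 0 < 1 + ((2 * Real.pi) * x) ^ 2 := by positivity
      simp only [Pi.mul_apply, Real.norm_eq_abs, sq_abs, Real.rpow_neg_one]
      rw [← Complex.ofReal_mul, mul_inv_cancel₀ hp.ne', Complex.ofReal_one]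
    rw [e5, TemperedDistribution.smulLeftCLM_const, one_smul]
  have e6 : T f = 0 := by
    have e7 : (𝓕⁻ (𝓕 (T f) : 𝓢'(ℝ, Spin)) : 𝓢'(ℝ, Spin)) = T f :=
      FourierTransform.fourierInv_fourier_eq _
    rw [← e7, e4]
    exact (FourierTransform.fourierInvCLM ℂ 𝓢'(ℝ, Spin)).map_zero
  exact LinearMap.ker_eq_bot'.mp (Lp.ker_toTemperedDistributionCLM_eq_bot
    (F := Spin) (μ := (volume : Measure ℝ)) (p := 2)) f e6

/-- The graph of the weak derivative restricted to Schwartz functions, in the Hilbert space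
`L² ⊕ L²`. -/
noncomputable def schwartzGraph : Submodule ℂ L2C4 :=
  LinearMap.range
    ((WithLp.linearEquiv 2 ℂ (L2C2 × L2C2)).symm.toLinearMap ∘ₗ
      ((SchwartzMap.toLpCLM ℂ Spin 2 (volume : Measure ℝ)).toLinearMap.prod
      ((SchwartzMap.toLpCLM ℂ Spin 2 (volume : Measure ℝ)).toLinearMap ∘ₗ
        (SchwartzMap.derivCLM ℂ Spin).toLinearMap)))

/-- Schwartz functions are dense in `H¹`: an element of `H¹` orthogonal to all of them
satisfies `f'' = f`. -/
theorem IsWeakDeriv.mem_closure_schwartzGraph {f h : L2C2} (hf : IsWeakDeriv f h) :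
    WithLp.toLp 2 (f, h) ∈ schwartzGraph.topologicalClosure := by
  set S := schwartzGraph.topologicalClosure with hS
  have hcl : ∀ p ∈ S, IsWeakDeriv p.fst p.snd := by
    have hc : IsClosed {p : L2C4 | IsWeakDeriv p.fst p.snd} :=
      isClosed_isWeakDeriv.preimage (WithLp.prod_continuous_ofLp 2 L2C2 L2C2)
    intro p hp
    refine closure_minimal ?_ hc hp
    rintro _ ⟨ψ, rfl⟩
    exact isWeakDeriv_toLp ψ
  have : CompleteSpace S := (Submodule.isClosed_topologicalClosure _).completeSpace_coe
  set g : L2C4 := WithLp.toLp 2 (f, h) with hg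
  -- The component of `g` orthogonal to the closure is `(f₀, f₀')` with `f₀'' = f₀`.
  set p : L2C4 := S.starProjection g with hp
  have hpS : p ∈ S := Submodule.starProjection_apply_mem S g
  have hq : ∀ k ∈ S, inner ℂ k (g - p) = 0 := fun k hk =>
    (Submodule.mem_orthogonal _ _).mp (Submodule.sub_starProjection_mem_orthogonal g) k hk
  have w1 : IsWeakDeriv (g - p).fst (g - p).snd := by
    have := hf.add ((hcl p hpS).smul (-1))
    simpa [hg, sub_eq_add_neg] using this
  have w2 : IsWeakDeriv (g - p).snd (g - p).fst := by
    refine IsWeakDeriv.of_forall_inner fun ψ => ?_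
    have := hq _ (Submodule.le_topologicalClosure _ ⟨ψ, rfl⟩)
    rw [WithLp.prod_inner_apply] at this
    rw [eq_neg_iff_add_eq_zero, add_comm]
    exact this
  have z1 := eq_zero_of_isWeakDeriv_of_isWeakDeriv w1 w2
  have z2 := eq_zero_of_isWeakDeriv_of_isWeakDeriv w2 w1
  have : g = p := by
    rw [← sub_eq_zero]
    exact WithLp.ofLp_injective 2 (Prod.ext z1 z2)
  rw [this]
  exact hpS

/-- To prove a closed property of `(f, f')` for `f ∈ H¹` it suffices to treat Schwartz
functions. -/
theorem IsWeakDeriv.induction {P : L2C2 → L2C2 → Prop}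
    (hP : IsClosed {p : L2C2 × L2C2 | P p.1 p.2})
    (hS : ∀ ψ : 𝓢(ℝ, Spin),
      P (ψ.toLp 2 volume) ((SchwartzMap.derivCLM ℂ Spin ψ).toLp 2 volume))
    {f h : L2C2} (hf : IsWeakDeriv f h) : P f h := by
  have hc : IsClosed {p : L2C4 | P p.fst p.snd} :=
    hP.preimage (WithLp.prod_continuous_ofLp 2 L2C2 L2C2)
  refine closure_minimal ?_ hc hf.mem_closure_schwartzGraph
  rintro _ ⟨ψ, rfl⟩
  exact hS ψ

/-- The weak derivative is skew-symmetric on `H¹`. -/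
theorem IsWeakDeriv.inner_eq_neg {f h k l : L2C2} (hf : IsWeakDeriv f h) (hk : IsWeakDeriv k l) :
    inner ℂ h k = - inner ℂ f l := by
  refine IsWeakDeriv.induction (P := fun f h => inner ℂ h k = - inner ℂ f l) ?_ (fun ψ => ?_) hf
  · apply isClosed_eq <;> fun_prop
  refine IsWeakDeriv.induction (P := fun k l => inner ℂ
    ((SchwartzMap.derivCLM ℂ Spin ψ).toLp 2 volume) k = - inner ℂ (ψ.toLp 2 volume) l)
    ?_ (fun χ => ?_) hk
  · apply isClosed_eq <;> fun_prop
  have := SchwartzMap.integral_bilinear_deriv_right_eq_neg_left ψ χ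
    ((isBoundedBilinearMap_inner (𝕜 := ℂ) (E := Spin)).toContinuousLinearMap)
  rw [SchwartzMap.inner_toL2_toL2_eq _ _ volume, SchwartzMap.inner_toL2_toL2_eq _ _ volume,
    eq_neg_iff_add_eq_zero, add_comm, ← eq_neg_iff_add_eq_zero]
  exact this

/-- The closed graph form of skew-adjointness of the weak derivative. -/
theorem IsWeakDeriv.of_forall_inner' {p q : L2C2}
    (H : ∀ f h : L2C2, IsWeakDeriv f h → inner ℂ p h = - inner ℂ q f) : IsWeakDeriv p q := by
  refine IsWeakDeriv.of_forall_inner fun ψ => ?_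
  have := congrArg conj (H _ _ (isWeakDeriv_toLp ψ))
  simpa [inner_conj_symm] using this

theorem intervalIntegrable_coeFn (k : L2C2) (x y : ℝ) : IntervalIntegrable k volume x y :=
  intervalIntegrable_iff.mpr
    (integrableOn_Lp_of_measure_ne_top k fact_one_le_two_ennreal.elim (by simp))

/-- Cauchy-Schwarz on an interval. -/
theorem norm_intervalIntegral_coeFn_le (k : L2C2) (x y : ℝ) :
    ‖∫ t in x..y, k t‖ ≤ √|y - x| * ‖k‖ := by
  rw [intervalIntegral.norm_intervalIntegral_eq]
  have hμ : volume (Set.uIoc x y) ≠ ∞ := by simp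
  set c := ∫ t in Set.uIoc x y, k t with hc
  have h1 := L2.inner_indicatorConstLp_eq_inner_setIntegral ℂ measurableSet_uIoc hμ c k
  have h2 : ‖c‖ ^ 2 ≤ ‖c‖ * √|y - x| * ‖k‖ := by
    have := norm_inner_le_norm (𝕜 := ℂ) (indicatorConstLp 2 measurableSet_uIoc hμ c) k
    rw [h1, ← hc, inner_self_eq_norm_sq_to_K, norm_indicatorConstLp (by simp) (by simp)] at this
    have e : volume.real (Set.uIoc x y) = |y - x| := by
      simp [Measure.real]
    rw [e] at this
    simpa [Real.sqrt_eq_rpow] using this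
  by_cases hz : ‖c‖ = 0
  · rw [hz]; positivity
  · have : 0 < ‖c‖ := lt_of_le_of_ne (norm_nonneg _) (Ne.symm hz)
    nlinarith

/-- A continuous representative of an element of `H¹` that is an antiderivative of the weak
derivative.  It is obtained along an almost everywhere convergent sequence of Schwartz
approximations. -/
theorem IsWeakDeriv.exists_continuous_rep {f h : L2C2} (hf : IsWeakDeriv f h) :
    ∃ F : ℝ → Spin, Continuous F ∧ f =ᵐ[volume] F ∧
      ∀ x y, F y - F x = ∫ t in x..y, h t := by
  have hloc := intervalIntegrable_coeFn
  obtain ⟨s, hs, hslim⟩ := mem_closure_iff_seq_limit.mp hf.mem_closure_schwartzGraph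
  choose ψ hψ using hs
  have hlim : Tendsto (fun n => (s n).fst) atTop (𝓝 f) :=
    ((WithLp.prod_continuous_ofLp 2 L2C2 L2C2).fst.tendsto _).comp hslim
  have hlim' : Tendsto (fun n => (s n).snd) atTop (𝓝 h) :=
    ((WithLp.prod_continuous_ofLp 2 L2C2 L2C2).snd.tendsto _).comp hslim
  have h1 : ∀ n, (s n).fst = (ψ n).toLp 2 volume := fun n => by rw [← hψ]; rfl
  have h2 : ∀ n, (s n).snd = (SchwartzMap.derivCLM ℂ Spin (ψ n)).toLp 2 volume :=
    fun n => by rw [← hψ]; rfl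
  obtain ⟨ns, hns, hae⟩ := (tendstoInMeasure_of_tendsto_Lp hlim).exists_seq_tendsto_ae
  have hae' : ∀ᵐ x, Tendsto (fun i => ψ (ns i) x) atTop (𝓝 (f x)) := by
    have := ae_all_iff.mpr fun n => (ψ n).coeFn_toLp 2 volume
    filter_upwards [hae, this] with x hx hy
    refine hx.congr fun i => ?_
    rw [h1, hy]
  obtain ⟨x₀, hx₀⟩ := hae'.exists
  have hint : ∀ x y, Tendsto (fun i => ∫ t in x..y, deriv (ψ (ns i)) t) atTop
      (𝓝 (∫ t in x..y, h t)) := by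
    intro x y
    rw [tendsto_iff_norm_sub_tendsto_zero]
    have hz : Tendsto (fun i => √|y - x| * ‖(s (ns i)).snd - h‖) atTop (𝓝 0) := by
      have := (tendsto_iff_norm_sub_tendsto_zero.mp (hlim'.comp hns.tendsto_atTop)).const_mul
        √|y - x|
      simpa using this
    refine squeeze_zero (fun _ => norm_nonneg _) (fun i => ?_) hz
    refine le_trans (le_of_eq ?_) (norm_intervalIntegral_coeFn_le _ x y)
    congr 1
    rw [h2]
    simp only [← SchwartzMap.derivCLM_apply ℂ]
    rw [← intervalIntegral.integral_sub
      ((SchwartzMap.derivCLM ℂ Spin (ψ (ns i))).continuous.intervalIntegrable _ _) (hloc h x y)]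
    refine intervalIntegral.integral_congr_ae ?_
    filter_upwards [(SchwartzMap.derivCLM ℂ Spin (ψ (ns i))).coeFn_toLp 2 volume,
      Lp.coeFn_sub ((SchwartzMap.derivCLM ℂ Spin (ψ (ns i))).toLp 2 volume) h] with t ht ht' _
    rw [ht', Pi.sub_apply, ht]
  have hftc : ∀ n x y, ψ n y - ψ n x = ∫ t in x..y, deriv (ψ n) t := by
    intro n x y
    refine (intervalIntegral.integral_eq_sub_of_hasDerivAt (fun t _ => (ψ n).hasDerivAt t) ?_).symm
    exact ((SchwartzMap.derivCLM ℂ Spin (ψ n)).continuous).intervalIntegrable _ _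
  refine ⟨fun x => f x₀ + ∫ t in x₀..x, h t, ?_, ?_, ?_⟩
  · exact continuous_const.add (intervalIntegral.continuous_primitive (hloc h) x₀)
  · filter_upwards [hae'] with x hx
    refine tendsto_nhds_unique hx ?_
    refine (hx₀.add (hint x₀ x)).congr fun i => ?_
    rw [← hftc, add_sub_cancel]
  · intro x y
    rw [add_sub_add_left_eq_sub,
      intervalIntegral.integral_interval_sub_left (hloc _ _ _) (hloc _ _ _)]

/-- Square integrable functions which are differentiable in the classical sense, with square
integrable derivative, are weakly differentiable. -/
theorem isWeakDeriv_of_hasDerivAt {F F' : ℝ → Spin} (hF : MemLp F 2 volume)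
    (hF' : MemLp F' 2 volume) (hd : ∀ x, HasDerivAt F (F' x) x) :
    IsWeakDeriv (hF.toLp F) (hF'.toLp F') := by
  unfold IsWeakDeriv
  ext1 η
  rw [TemperedDistribution.derivCLM_apply_apply]
  simp only [Lp.toTemperedDistributionCLM_apply, Lp.toTemperedDistribution_apply]
  have e1 : ∀ (χ : 𝓢(ℝ, ℂ)) {K : ℝ → Spin} (hK : MemLp K 2 volume),
      ∫ x, χ x • (hK.toLp K) x = ∫ x, χ x • K x := fun χ K hK => by
    refine integral_congr_ae ?_
    filter_upwards [hK.coeFn_toLp] with x hx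
    rw [hx]
  rw [e1, e1]
  have hi : ∀ (χ : 𝓢(ℝ, ℂ)) {K : ℝ → Spin} (hK : MemLp K 2 volume),
      Integrable (fun x => χ x • K x) := fun χ K hK =>
    memLp_one_iff_integrable.mp (hK.smul (χ.memLp 2 volume))
  have := integral_bilinear_hasDerivAt_right_eq_neg_left_of_integrable
    (L := ContinuousLinearMap.lsmul ℝ ℂ (E := Spin)) (u := η) (u' := deriv η) (v := F) (v' := F')
    (fun x _ => η.hasDerivAt x) (fun x _ => hd x) (hi η hF')
    (hi (SchwartzMap.derivCLM ℂ ℂ η) hF) (hi η hF)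
  simp only [ContinuousLinearMap.lsmul_apply] at this
  rw [this, ← integral_neg]
  simp

/-- Weak differentiation commutes with constant matrices. -/
theorem IsWeakDeriv.compLp {f h : L2C2} (hf : IsWeakDeriv f h) (B : Spin →L[ℂ] Spin) :
    IsWeakDeriv (B.compLp f) (B.compLp h) := by
  unfold IsWeakDeriv at *
  have key : ∀ (k : L2C2) (η : 𝓢(ℝ, ℂ)), Lp.toTemperedDistributionCLM Spin volume 2 (B.compLp k) η
      = B (Lp.toTemperedDistributionCLM Spin volume 2 k η) := by
    intro k η
    simp only [Lp.toTemperedDistributionCLM_apply, Lp.toTemperedDistribution_apply]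
    rw [← B.integral_comp_comm]
    · refine integral_congr_ae ?_
      filter_upwards [B.coeFn_compLp k] with x hx
      rw [hx, map_smul]
    · exact memLp_one_iff_integrable.mp ((Lp.memLp k).smul (η.memLp 2 volume))
  ext1 η
  rw [TemperedDistribution.derivCLM_apply_apply, key, key, ← hf,
    TemperedDistribution.derivCLM_apply_apply]

end NLDirac

namespace NLDirac
open Filter Topology ComplexConjugate
open scoped SchwartzMap LineDeriv FourierTransform BoundedContinuousFunction

/-! ### Multiplication operators and Dirac operators on the line -/

theorem memLp_bcf_apply (A : ℝ →ᵇ (Spin →L[ℂ] Spin)) {f : ℝ → Spin} (hf : MemLp f 2 volume) :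
    MemLp (fun x => A x (f x)) 2 volume := by
  refine MemLp.of_le_mul (c := ‖A‖) hf ?_ (Eventually.of_forall fun x => ?_)
  · exact isBoundedBilinearMap_apply.continuous.comp_aestronglyMeasurable
      (A.continuous.aestronglyMeasurable.prodMk hf.1)
  · exact (A x).le_of_opNorm_le (A.norm_coe_le_norm x) (f x)

/-- Multiplication by a bounded continuous matrix-valued function, as a bounded operator. -/
noncomputable def mulCLM (A : ℝ →ᵇ (Spin →L[ℂ] Spin)) : L2C2 →L[ℂ] L2C2 :=
  LinearMap.mkContinuous
    { toFun := fun f => (memLp_bcf_apply A (Lp.memLp f)).toLp _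
      map_add' := fun f k => by
        rw [← MemLp.toLp_add]
        refine MemLp.toLp_congr _ _ ?_
        filter_upwards [Lp.coeFn_add f k] with x hx
        rw [hx, Pi.add_apply, map_add, Pi.add_apply]
      map_smul' := fun c f => by
        rw [RingHom.id_apply, ← MemLp.toLp_const_smul]
        refine MemLp.toLp_congr _ _ ?_
        filter_upwards [Lp.coeFn_smul c f] with x hx
        rw [hx, Pi.smul_apply, map_smul, Pi.smul_apply] } ‖A‖ fun f => by
    refine Lp.norm_le_mul_norm_of_ae_le_mul ?_
    filter_upwards [(memLp_bcf_apply A (Lp.memLp f)).coeFn_toLp] with x hx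
    rw [LinearMap.coe_mk, AddHom.coe_mk, hx]
    exact (A x).le_of_opNorm_le (A.norm_coe_le_norm x) (f x)

theorem coeFn_mulCLM (A : ℝ →ᵇ (Spin →L[ℂ] Spin)) (f : L2C2) :
    mulCLM A f =ᵐ[volume] fun x => A x (f x) :=
  (memLp_bcf_apply A (Lp.memLp f)).coeFn_toLp

theorem mulCLM_sub (A B : ℝ →ᵇ (Spin →L[ℂ] Spin)) : mulCLM (A - B) = mulCLM A - mulCLM B := by
  ext1 f
  refine Lp.ext ?_
  filter_upwards [coeFn_mulCLM A f, coeFn_mulCLM B f, coeFn_mulCLM (A - B) f,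
    Lp.coeFn_sub (mulCLM A f) (mulCLM B f)] with x h1 h2 h3 h4
  rw [sub_apply (mulCLM A), h3, h4, Pi.sub_apply, h1, h2]
  rfl

theorem inner_mulCLM (A : ℝ →ᵇ (Spin →L[ℂ] Spin))
    (hA : ∀ x a b, inner ℂ (A x a) b = inner ℂ a (A x b)) (p f : L2C2) :
    inner ℂ (mulCLM A p) f = inner ℂ p (mulCLM A f) := by
  rw [L2.inner_def, L2.inner_def]
  refine integral_congr_ae ?_
  filter_upwards [coeFn_mulCLM A p, coeFn_mulCLM A f] with x h1 h2
  rw [h1, h2, hA]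

/-- The matrix `[[0, 1], [-1, 0]]`. -/
noncomputable def J : Spin →L[ℂ] Spin := Matrix.toEuclideanCLM (𝕜 := ℂ) (n := Fin 2) !![0, 1; -1, 0]

theorem J_apply (a : Spin) : J a = !₂[a 1, - a 0] := by
  ext i
  fin_cases i <;> simp [J, Matrix.ofLp_toEuclideanCLM, Matrix.vecHead, Matrix.vecTail]

theorem J_J (a : Spin) : J (J a) = -a := by
  ext i
  fin_cases i <;> simp [J_apply]

theorem inner_J (a b : Spin) : inner ℂ (J a) b = - inner ℂ a (J b) := by
  simp [J_apply, PiLp.inner_apply, Fin.sum_univ_two]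

/-- `J` acting pointwise on `L²(ℝ, ℂ²)`. -/
noncomputable abbrev JL : L2C2 →L[ℂ] L2C2 := J.compLpL 2 (volume : Measure ℝ)

theorem JL_JL (f : L2C2) : JL (JL f) = -f := by
  refine Lp.ext ?_
  filter_upwards [J.coeFn_compLpL (p := 2) (JL f), J.coeFn_compLpL (p := 2) f,
    Lp.coeFn_neg f] with x h1 h2 h3
  rw [h1, h2, h3, J_J, Pi.neg_apply]

theorem inner_JL (p f : L2C2) : inner ℂ (JL p) f = - inner ℂ p (JL f) := by
  rw [L2.inner_def, L2.inner_def, ← integral_neg]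
  refine integral_congr_ae ?_
  filter_upwards [J.coeFn_compLpL (p := 2) p, J.coeFn_compLpL (p := 2) f] with x h1 h2
  rw [h1, h2, inner_J]

theorem IsWeakDeriv.JL {f h : L2C2} (hf : IsWeakDeriv f h) : IsWeakDeriv (JL f) (JL h) :=
  hf.compLp J

theorem IsWeakDeriv.mem_domain {f h : L2C2} (hf : IsWeakDeriv f h) : f ∈ dx.domain := ⟨h, hf⟩

theorem isWeakDeriv_dx (f : dx.domain) : IsWeakDeriv f (dx f) := f.2.choose_spec

/-- For a bounded continuous potential, the Dirac operator is defined on all of `H¹`. -/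
theorem mem_graph_diracOp {M : ℝ → Matrix (Fin 2) (Fin 2) ℂ} {A : ℝ →ᵇ (Spin →L[ℂ] Spin)}
    (hA : ∀ x, A x = Matrix.toEuclideanCLM (𝕜 := ℂ) (M x)) {f k : L2C2} :
    (f, k) ∈ (diracOp M).graph ↔ ∃ h, IsWeakDeriv f h ∧ k = JL h + mulCLM A f := by
  have hm : ∀ f : L2C2, MemLp (matMul M f) 2 volume := fun f => by
    have := memLp_bcf_apply A (Lp.memLp f)
    simp only [hA] at this
    exact this
  have hv : ∀ f : L2C2, (hm f).toLp _ = mulCLM A f := fun f => by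
    refine Lp.ext ?_
    filter_upwards [coeFn_mulCLM A f, (hm f).coeFn_toLp] with x h1 h2
    rw [h1, h2, hA]
    rfl
  rw [LinearPMap.mem_graph_iff]
  constructor
  · rintro ⟨y, rfl, rfl⟩
    refine ⟨dx ⟨y, y.2.1⟩, isWeakDeriv_dx ⟨y, y.2.1⟩, ?_⟩
    rw [← hv]
    rfl
  · rintro ⟨h, hf, rfl⟩
    refine ⟨⟨f, hf.mem_domain, hm f⟩, rfl, ?_⟩
    have hd := (isWeakDeriv_dx ⟨f, hf.mem_domain⟩).unique hf
    change JL (dx ⟨f, hf.mem_domain⟩) + (hm f).toLp _ = JL h + mulCLM A f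
    rw [hd, hv]

/-- Self-adjointness of an operator in terms of its graph: `T` coincides, as a relation, with its
adjoint.  Density of the domain need not be assumed, since it follows from the adjoint relation
being the graph of a function. -/
def IsGraphSelfAdjoint {E : Type*} [NormedAddCommGroup E] [InnerProductSpace ℂ E]
    (T : E →ₗ.[ℂ] E) : Prop :=
  ∀ p q, (p, q) ∈ T.graph ↔ ∀ f k, (f, k) ∈ T.graph → inner ℂ p k = inner ℂ q f

/-- A Dirac operator with a Hermitian bounded continuous potential is self-adjoint. -/
theorem isGraphSelfAdjoint_diracOp {M : ℝ → Matrix (Fin 2) (Fin 2) ℂ}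
    {A : ℝ →ᵇ (Spin →L[ℂ] Spin)} (hA : ∀ x, A x = Matrix.toEuclideanCLM (𝕜 := ℂ) (M x))
    (hs : ∀ x a b, inner ℂ (A x a) b = inner ℂ a (A x b)) :
    IsGraphSelfAdjoint (diracOp M) := by
  intro p q
  simp only [mem_graph_diracOp hA]
  constructor
  · rintro ⟨p', hp, rfl⟩ f k ⟨h, hf, rfl⟩
    rw [inner_add_right, inner_add_left, inner_mulCLM A hs]
    congr 1
    rw [hp.JL.inner_eq_neg hf, inner_JL, neg_neg]
  · intro H
    have h1 : IsWeakDeriv (JL p) (q - mulCLM A p) := by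
      refine IsWeakDeriv.of_forall_inner' fun f h hf => ?_
      have := H f _ ⟨h, hf, rfl⟩
      rw [inner_add_right, ← inner_mulCLM A hs] at this
      rw [inner_sub_left, inner_JL, ← this]
      ring
    refine ⟨-JL (q - mulCLM A p), ?_, ?_⟩
    · have := h1.JL.smul (-1)
      rw [JL_JL] at this
      simpa using this
    · rw [map_neg, JL_JL]
      abel

end NLDirac

namespace LinearPMap
open Filter Topology ComplexConjugate

variable {E : Type*} [NormedAddCommGroup E] [NormedSpace ℂ E]

/-! ### Spectral notions in terms of the graph -/

theorem subScalarGraph_apply (T : E →ₗ.[ℂ] E) (z : ℂ) (p : T.graph) :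
    T.subScalarGraph z p = p.1.2 - z • p.1.1 := rfl

theorem isEigenvector_iff_mem_graph {T : E →ₗ.[ℂ] E} {z : ℂ} {f : E} :
    T.IsEigenvector z f ↔ f ≠ 0 ∧ (f, z • f) ∈ T.graph := by
  refine and_congr_right fun _ => ?_
  rw [mem_graph_iff]
  constructor
  · rintro ⟨hf, h⟩
    exact ⟨⟨f, hf⟩, rfl, h⟩
  · rintro ⟨y, hy, h⟩
    simp only at hy h
    subst hy
    exact ⟨y.2, h⟩

theorem range_subScalar (T : E →ₗ.[ℂ] E) (z : ℂ) :
    Set.range (T.subScalar z) = Set.range (T.subScalarGraph z) := by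
  ext k
  constructor
  · rintro ⟨f, rfl⟩
    exact ⟨⟨(f, T f), T.mem_graph f⟩, rfl⟩
  · rintro ⟨⟨⟨f, l⟩, hp⟩, rfl⟩
    obtain ⟨y, hy, h⟩ := (mem_graph_iff _).mp hp
    simp only at hy h
    subst hy h
    exact ⟨y, rfl⟩

theorem injective_subScalar_iff {T : E →ₗ.[ℂ] E} {z : ℂ} :
    Function.Injective (T.subScalar z) ↔ z ∉ T.pointSpectrum := by
  rw [injective_iff_map_eq_zero, pointSpectrum, Set.mem_ofPred_eq]
  constructor
  · rintro H ⟨f, hf0, hf, h⟩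
    refine hf0 (congrArg Subtype.val (H ⟨f, hf⟩ ?_))
    change T ⟨f, hf⟩ - z • f = 0
    rw [h, sub_self]
  · intro H f hf
    by_contra h0
    refine H ⟨f, fun h => h0 (Subtype.ext h), f.2, ?_⟩
    exact sub_eq_zero.mp hf

theorem mem_nullSpace_iff {T : E →ₗ.[ℂ] E} {f : E} : f ∈ T.nullSpace ↔ (f, 0) ∈ T.graph := by
  rw [nullSpace, Submodule.mem_map, mem_graph_iff]
  constructor
  · rintro ⟨y, hy, rfl⟩
    exact ⟨y, rfl, hy⟩
  · rintro ⟨y, hy, h⟩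
    exact ⟨y, h, hy⟩

/-- For a closed operator `T` the graph is complete, so a bijective `T - z` has a bounded inverse by
the open mapping theorem. -/
theorem isFredholm_of_bijective [CompleteSpace E] {T : E →ₗ.[ℂ] E}
    (hT : _root_.IsClosed (T.graph : Set (E × E))) {z : ℂ}
    (hb : Function.Bijective (T.subScalarGraph z)) : (T.subScalarGraph z).IsFredholm := by
  have : CompleteSpace T.graph := hT.completeSpace_coe
  let e := ContinuousLinearEquiv.ofBijective (T.subScalarGraph z)
    (LinearMap.ker_eq_bot.mpr hb.1) (LinearMap.range_eq_top.mpr hb.2)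
  refine ContinuousLinearMap.IsFredholm.of_isQuasiInverse (v := (e.symm : E →L[ℂ] T.graph)) ?_
  exact e.toLinearEquiv.isQuasiInverse

/-- The continuous spectrum in the narrow sense consists of the points of the essential spectrum
which are not eigenvalues and at which `T - z` has dense range. -/
theorem continuousSpectrum_eq [CompleteSpace E] {T : E →ₗ.[ℂ] E}
    (hT : _root_.IsClosed (T.graph : Set (E × E)))
    (hd : ∀ z ∈ T.essentialSpectrum, z ∉ T.pointSpectrum → DenseRange (T.subScalar z)) :
    T.continuousSpectrum = T.essentialSpectrum \ T.pointSpectrum := by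
  ext z
  simp only [continuousSpectrum, Set.mem_ofPred_eq, Set.mem_sdiff, injective_subScalar_iff]
  constructor
  · rintro ⟨h1, h2, h3⟩
    -- A Fredholm operator has closed range, so dense range would mean surjectivity.
    refine ⟨fun hF => h3 ?_, h1⟩
    have hc : _root_.IsClosed (Set.range (T.subScalarGraph z)) := hF.isClosed_range
    rw [← range_subScalar] at hc
    rw [← Set.range_eq_univ, ← hc.closure_eq, h2.closure_eq]
  · rintro ⟨h1, h2⟩
    refine ⟨h2, hd z h1 h2, fun hs => h1 (isFredholm_of_bijective hT ⟨?_, ?_⟩)⟩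
    · rw [injective_iff_map_eq_zero]
      rintro ⟨⟨f, l⟩, hp⟩ h0
      have hl : l = z • f := sub_eq_zero.mp h0
      subst hl
      have : f = 0 := by
        by_contra hf
        exact h2 ⟨f, isEigenvector_iff_mem_graph.mpr ⟨hf, hp⟩⟩
      subst this
      simp
    · rw [← Set.range_eq_univ, ← range_subScalar]
      exact hs.range_eq

end LinearPMap

namespace NLDirac
open Filter Topology ComplexConjugate

/-! ### Block operators built from self-adjoint operators -/

theorem IsGraphSelfAdjoint.isClosed_graph {E : Type*} [NormedAddCommGroup E]
    [InnerProductSpace ℂ E] {T : E →ₗ.[ℂ] E} (hT : IsGraphSelfAdjoint T) :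
    IsClosed (T.graph : Set (E × E)) := by
  have : (T.graph : Set (E × E)) =
      ⋂ (p : E × E) (_ : p ∈ T.graph), {q : E × E | inner ℂ q.1 p.2 = inner ℂ q.2 p.1} := by
    ext ⟨p, q⟩
    simp only [SetLike.mem_coe, Set.mem_iInter, Set.mem_ofPred_eq, Prod.forall]
    exact hT p q
  rw [this]
  refine isClosed_iInter fun p => isClosed_iInter fun _ => ?_
  apply isClosed_eq <;> fun_prop

theorem mem_graph_blockOp {A B : L2C2 →ₗ.[ℂ] L2C2} {f k : L2C4} :
    (f, k) ∈ (blockOp A B).graph ↔ (f.snd, k.fst) ∈ A.graph ∧ (f.fst, -k.snd) ∈ B.graph := by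
  simp only [LinearPMap.mem_graph_iff]
  constructor
  · rintro ⟨y, rfl, rfl⟩
    exact ⟨⟨⟨y.1.snd, y.2.2⟩, rfl, rfl⟩, ⟨⟨y.1.fst, y.2.1⟩, rfl, (neg_neg _).symm⟩⟩
  · rintro ⟨⟨a, ha, ha'⟩, b, hb, hb'⟩
    refine ⟨⟨f, hb ▸ b.2, ha ▸ a.2⟩, rfl, WithLp.ofLp_injective 2 (Prod.ext ?_ ?_)⟩
    · exact (congrArg A (Subtype.ext ha.symm)).trans ha'
    · exact (congrArg Neg.neg ((congrArg B (Subtype.ext hb.symm)).trans hb')).trans (neg_neg _)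

theorem isClosed_graph_blockOp {A B : L2C2 →ₗ.[ℂ] L2C2} (hA : IsGraphSelfAdjoint A)
    (hB : IsGraphSelfAdjoint B) : IsClosed ((blockOp A B).graph : Set (L2C4 × L2C4)) := by
  have : ((blockOp A B).graph : Set (L2C4 × L2C4)) =
      (fun p : L2C4 × L2C4 => (p.1.snd, p.2.fst)) ⁻¹' (A.graph : Set (L2C2 × L2C2)) ∩
      (fun p : L2C4 × L2C4 => (p.1.fst, -p.2.snd)) ⁻¹' (B.graph : Set (L2C2 × L2C2)) := by
    ext ⟨f, k⟩
    exact mem_graph_blockOp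
  rw [this]
  have c1 : Continuous (fun p : L2C4 => p.fst) := (WithLp.prod_continuous_ofLp 2 L2C2 L2C2).fst
  have c2 : Continuous (fun p : L2C4 => p.snd) := (WithLp.prod_continuous_ofLp 2 L2C2 L2C2).snd
  refine (hA.isClosed_graph.preimage ?_).inter (hB.isClosed_graph.preimage ?_)
  · exact (c2.comp continuous_fst).prodMk (c1.comp continuous_snd)
  · exact (c1.comp continuous_fst).prodMk (c2.comp continuous_snd).neg

/-- The adjoint of `[[0, A], [-B, 0]]` is conjugate to the operator itself by the exchange of the
two components. -/
theorem swap_mem_graph_of_orthogonal {A B : L2C2 →ₗ.[ℂ] L2C2} (hA : IsGraphSelfAdjoint A)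
    (hB : IsGraphSelfAdjoint B) {z : ℂ} {k : L2C4}
    (H : ∀ f l, (f, l) ∈ (blockOp A B).graph → inner ℂ k (l - z • f) = 0) :
    (WithLp.toLp 2 (k.snd, k.fst), conj z • (WithLp.toLp 2 (k.snd, k.fst) : L2C4))
      ∈ (blockOp A B).graph := by
  refine mem_graph_blockOp.mpr ⟨(hA _ _).mpr fun f a hf => ?_, (hB _ _).mpr fun f b hf => ?_⟩
  · have := H (WithLp.toLp 2 (0, f)) (WithLp.toLp 2 (a, 0))
      (mem_graph_blockOp.mpr ⟨hf, by simp⟩)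
    rw [WithLp.prod_inner_apply] at this
    simp [inner_smul_right] at this ⊢
    linear_combination this
  · have := H (WithLp.toLp 2 (f, 0)) (WithLp.toLp 2 (0, -b))
      (mem_graph_blockOp.mpr ⟨by simp, by simpa using hf⟩)
    rw [WithLp.prod_inner_apply] at this
    simp [inner_smul_right, inner_smul_left] at this ⊢
    linear_combination -this

/-- Changing the sign of one component conjugates a block operator to its negative. -/
theorem flip_mem_graph {A B : L2C2 →ₗ.[ℂ] L2C2} {z : ℂ} {f : L2C4}
    (hf : (f, z • f) ∈ (blockOp A B).graph) :
    (WithLp.toLp 2 (f.fst, -f.snd), (-z) • (WithLp.toLp 2 (f.fst, -f.snd) : L2C4))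
      ∈ (blockOp A B).graph := by
  obtain ⟨h1, h2⟩ := mem_graph_blockOp.mp hf
  refine mem_graph_blockOp.mpr ⟨?_, ?_⟩
  · simpa using A.graph.neg_mem h1
  · simpa using h2

theorem denseRange_of_forall_inner_eq_zero {T : L2C4 →ₗ.[ℂ] L2C4} {z : ℂ}
    (H : ∀ k, (∀ f l, (f, l) ∈ T.graph → inner ℂ k (l - z • f) = 0) → k = 0) :
    DenseRange (T.subScalarGraph z) := by
  have h1 : (LinearMap.range (T.subScalarGraph z).toLinearMap)ᗮ = ⊥ := by
    rw [Submodule.eq_bot_iff]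
    intro k hk
    refine H k fun f l hfl => ?_
    exact (Submodule.mem_orthogonal' _ _).mp hk _ ⟨⟨(f, l), hfl⟩, rfl⟩
  have := (Submodule.dense_iff_topologicalClosure_eq_top).mpr
    (Submodule.topologicalClosure_eq_top_iff.mpr h1)
  exact this

/-- At a purely imaginary number which is not an eigenvalue, a block operator has dense range: a
vector `k` orthogonal to the range gives the eigenvector `(k₂, -k₁)` with eigenvalue `-conj z = z`.
-/
theorem denseRange_blockOp {A B : L2C2 →ₗ.[ℂ] L2C2} (hA : IsGraphSelfAdjoint A)
    (hB : IsGraphSelfAdjoint B) {z : ℂ} (hz : z.re = 0) (hp : z ∉ (blockOp A B).pointSpectrum) :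
    DenseRange ((blockOp A B).subScalar z) := by
  rw [DenseRange, LinearPMap.range_subScalar]
  refine denseRange_of_forall_inner_eq_zero fun k hk => ?_
  have h1 := flip_mem_graph (swap_mem_graph_of_orthogonal hA hB hk)
  have h2 : -conj z = z := by
    apply Complex.ext <;> simp [hz]
  rw [h2] at h1
  by_contra h0
  refine hp ⟨_, LinearPMap.isEigenvector_iff_mem_graph.mpr ⟨fun h => h0 ?_, h1⟩⟩
  have e1 := congrArg WithLp.fst h
  have e2 := congrArg WithLp.snd h
  simp at e1 e2
  exact WithLp.ofLp_injective 2 (Prod.ext e2 e1)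

/-- The resolvent estimate for a skew-adjoint block operator with a spectral gap.  Off the
imaginary axis it follows from skew-adjointness, on the axis from the gap. -/
theorem exists_lower_bound_blockOp {S : L2C2 →ₗ.[ℂ] L2C2} (hS : IsGraphSelfAdjoint S) {m : ℝ}
    (hm : 0 < m) (hgap : ∀ f k, (f, k) ∈ S.graph → m * ‖f‖ ≤ ‖k‖) {z : ℂ}
    (hz : ¬ (z.re = 0 ∧ m ≤ |z.im|)) :
    ∃ c > 0, ∀ f l, (f, l) ∈ (blockOp S S).graph → c * ‖f‖ ≤ ‖l - z • f‖ := by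
  by_cases hre : z.re = 0
  · have him : |z.im| < m := by
      by_contra h
      exact hz ⟨hre, not_lt.mp h⟩
    have hnz : ‖z‖ = |z.im| := by
      rw [← sq_eq_sq₀ (norm_nonneg _) (abs_nonneg _), Complex.sq_norm, Complex.normSq_apply, hre,
        sq_abs]
      ring
    refine ⟨m - |z.im|, by linarith, fun f l hfl => ?_⟩
    obtain ⟨h1, h2⟩ := mem_graph_blockOp.mp hfl
    have e1 := hgap _ _ h1
    have e2 := hgap _ _ h2
    rw [norm_neg] at e2
    have e3 : m * ‖f‖ ≤ ‖l‖ := by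
      refine le_of_sq_le_sq ?_ (norm_nonneg _)
      rw [mul_pow, WithLp.prod_norm_sq_eq_of_L2, WithLp.prod_norm_sq_eq_of_L2]
      have := pow_le_pow_left₀ (by positivity) e1 2
      have := pow_le_pow_left₀ (by positivity) e2 2
      nlinarith
    have e4 := norm_sub_norm_le l (z • f)
    rw [norm_smul, hnz] at e4
    linarith
  · refine ⟨|z.re|, abs_pos.mpr hre, fun f l hfl => ?_⟩
    obtain ⟨h1, h2⟩ := mem_graph_blockOp.mp hfl
    have e1 : (inner ℂ l f).re = 0 := by
      rw [WithLp.prod_inner_apply]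
      have := (hS _ _).mp h1 _ _ h2
      have e := congrArg Complex.re this
      rw [inner_neg_right, Complex.neg_re, ← inner_conj_symm, Complex.conj_re] at e
      rw [Complex.add_re]
      change (inner ℂ l.fst f.fst).re + (inner ℂ l.snd f.snd).re = 0
      linarith
    have e2 : (inner ℂ (l - z • f) f).re = - (z.re * ‖f‖ ^ 2) := by
      rw [inner_sub_left, inner_smul_left, Complex.sub_re, e1, inner_self_eq_norm_sq_to_K,
        Complex.mul_re]
      simp [← Complex.ofReal_pow]
    by_cases hf : ‖f‖ = 0
    · rw [hf]; simp
    have hf' : 0 < ‖f‖ := lt_of_le_of_ne (norm_nonneg _) (Ne.symm hf)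
    have e3 := (Complex.abs_re_le_norm _).trans (norm_inner_le_norm (𝕜 := ℂ) (l - z • f) f)
    rw [e2, abs_neg, abs_mul, abs_of_nonneg (by positivity : 0 ≤ ‖f‖ ^ 2)] at e3
    nlinarith

/-- Outside `{z ∈ iℝ : |Im z| ≥ m}` the block operator of a self-adjoint operator with spectral
gap `(-m, m)` has a bounded inverse: the resolvent estimate at `z` makes the range of the operator
closed, and the one at `conj z` makes it dense. -/
theorem bijective_subScalarGraph_blockOp {S : L2C2 →ₗ.[ℂ] L2C2} (hS : IsGraphSelfAdjoint S) {m : ℝ}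
    (hm : 0 < m) (hgap : ∀ f k, (f, k) ∈ S.graph → m * ‖f‖ ≤ ‖k‖) {z : ℂ}
    (hz : ¬ (z.re = 0 ∧ m ≤ |z.im|)) :
    Function.Bijective ((blockOp S S).subScalarGraph z) := by
  have hcl := isClosed_graph_blockOp hS hS
  have : CompleteSpace (blockOp S S).graph := hcl.completeSpace_coe
  obtain ⟨c, hc, hb⟩ := exists_lower_bound_blockOp hS hm hgap hz
  obtain ⟨c', hc', hb'⟩ := exists_lower_bound_blockOp hS hm hgap (z := conj z) (by simpa using hz)
  have hanti : AntilipschitzWith (Real.toNNReal (1 / c + 1 + ‖z‖ / c))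
      ((blockOp S S).subScalarGraph z) := by
    refine ContinuousLinearMap.antilipschitz_of_bound _ ?_
    rintro ⟨⟨f, l⟩, hp⟩
    rw [Real.coe_toNNReal _ (by positivity), LinearPMap.subScalarGraph_apply]
    have h1 := hb f l hp
    have h2 : ‖f‖ ≤ 1 / c * ‖l - z • f‖ := by
      rw [one_div, ← div_eq_inv_mul, le_div_iff₀ hc]; linarith
    have h3 : ‖l‖ ≤ (1 + ‖z‖ / c) * ‖l - z • f‖ := by
      have : ‖l‖ ≤ ‖l - z • f‖ + ‖z • f‖ := by
        simpa using norm_add_le (l - z • f) (z • f)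
      rw [norm_smul] at this
      have h4 := mul_le_mul_of_nonneg_left h2 (norm_nonneg z)
      calc ‖l‖ ≤ ‖l - z • f‖ + ‖z‖ * (1 / c * ‖l - z • f‖) := by linarith
        _ = _ := by ring
    have h0 := norm_nonneg (l - z • f)
    have h5 : 0 ≤ 1 / c := by positivity
    have h6 : 0 ≤ ‖z‖ / c := by positivity
    change max ‖f‖ ‖l‖ ≤ (1 / c + 1 + ‖z‖ / c) * ‖l - z • f‖
    refine max_le ?_ ?_ <;> nlinarith [mul_nonneg h5 h0, mul_nonneg h6 h0]
  refine ⟨hanti.injective, ?_⟩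
  have hclr := hanti.isClosed_range ((blockOp S S).subScalarGraph z).uniformContinuous
  rw [← Set.range_eq_univ, ← hclr.closure_eq]
  refine (denseRange_of_forall_inner_eq_zero fun k hk => ?_).closure_eq
  have h1 := hb' _ _ (swap_mem_graph_of_orthogonal hS hS hk)
  rw [sub_self, norm_zero] at h1
  have h2 : ‖(WithLp.toLp 2 (k.snd, k.fst) : L2C4)‖ = 0 :=
    le_antisymm (by by_contra h; push Not at h; nlinarith) (norm_nonneg _)
  rw [norm_eq_zero] at h2
  have e1 := congrArg WithLp.fst h2
  have e2 := congrArg WithLp.snd h2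
  exact WithLp.ofLp_injective 2 (Prod.ext e2 e1)

end NLDirac

namespace LinearPMap
open Filter Topology ComplexConjugate
open scoped LinearMap.FiniteRangeSetoid

/-! ### Stability and failure of the Fredholm property -/

/-- The finite rank operators, as a subspace of the bounded operators. -/
def finiteRankCLM (X Y : Type*) [NormedAddCommGroup X] [NormedSpace ℂ X] [NormedAddCommGroup Y]
    [NormedSpace ℂ Y] : Submodule ℂ (X →L[ℂ] Y) :=
  (LinearMap.finiteRange ℂ X Y).comap (ContinuousLinearMap.coeLM ℂ)

variable {E : Type*} [NormedAddCommGroup E] [NormedSpace ℂ E]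

/-- An invertible operator stays Fredholm under a perturbation which is a norm limit of finite
rank operators. -/
theorem isFredholm_add_of_mem_closure {X Y : Type*} [NormedAddCommGroup X] [NormedSpace ℂ X]
    [CompleteSpace X] [NormedAddCommGroup Y] [NormedSpace ℂ Y]
    (e : X ≃L[ℂ] Y) {C : X →L[ℂ] Y}
    (hC : C ∈ (finiteRankCLM X Y).topologicalClosure) :
    ∃ v : Y →L[ℂ] X, v.IsQuasiInverse ((e : X →L[ℂ] Y) + C) := by
  have hopen : IsOpen ((fun F : X →L[ℂ] Y => (e : X →L[ℂ] Y) + C - F) ⁻¹'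
      Set.range ((↑) : (X ≃L[ℂ] Y) → X →L[ℂ] Y)) :=
    ContinuousLinearEquiv.isOpen.preimage (by fun_prop)
  obtain ⟨F, ⟨e', he'⟩, hF⟩ := mem_closure_iff.mp hC _ hopen ⟨e, by simp⟩
  simp only at he'
  -- If `C` is close to `F` of finite rank, then `e' = e + C - F` is still invertible, and its
  -- inverse is a quasi-inverse of `e + C`.
  refine ⟨(e'.symm : Y →L[ℂ] X), ?_⟩
  refine e'.toLinearEquiv.isQuasiInverse.congr (Setoid.refl _) ?_
  rw [LinearMap.FiniteRangeSetoid.equiv_iff_hasNoetherianRange]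
  have h1 : (((e : X →L[ℂ] Y) + C : X →L[ℂ] Y) : X →ₗ[ℂ] Y) - (e'.toLinearEquiv : X →ₗ[ℂ] Y)
      = (F : X →ₗ[ℂ] Y) := by
    ext x
    have := DFunLike.congr_fun he' x
    change e' x = e x + C x - F x at this
    change e x + C x - e' x = F x
    rw [this]
    abel
  exact (congrArg LinearMap.HasNoetherianRange h1).mpr hF

/-- A relatively compact bounded perturbation of an operator with `T₀ - z` invertible is
Fredholm at `z`; relative compactness enters as approximability by finite rank operators in the
graph norm of `T₀`. -/
theorem isFredholm_of_perturbation [CompleteSpace E] {T T₀ : E →ₗ.[ℂ] E} {V : E →L[ℂ] E}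
    (hg : ∀ f k, (f, k) ∈ T.graph ↔ (f, k - V f) ∈ T₀.graph)
    (hT₀ : _root_.IsClosed (T₀.graph : Set (E × E))) {z : ℂ}
    (hb : Function.Bijective (T₀.subScalarGraph z))
    (hV : V ∘L (ContinuousLinearMap.fst ℂ E E) ∘L T₀.graph.subtypeL ∈
      (finiteRankCLM T₀.graph E).topologicalClosure) :
    (T.subScalarGraph z).IsFredholm := by
  have : CompleteSpace T₀.graph := hT₀.completeSpace_coe
  let e := ContinuousLinearEquiv.ofBijective (T₀.subScalarGraph z)
    (LinearMap.ker_eq_bot.mpr hb.1) (LinearMap.range_eq_top.mpr hb.2)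
  obtain ⟨v, hv⟩ := isFredholm_add_of_mem_closure e hV
  -- The graphs of `T` and `T₀` are identified by a shear.
  let s : E × E →L[ℂ] E × E := (ContinuousLinearMap.fst ℂ E E).prod
    (ContinuousLinearMap.snd ℂ E E - V ∘L ContinuousLinearMap.fst ℂ E E)
  let s' : E × E →L[ℂ] E × E := (ContinuousLinearMap.fst ℂ E E).prod
    (ContinuousLinearMap.snd ℂ E E + V ∘L ContinuousLinearMap.fst ℂ E E)
  let Φ : T.graph ≃L[ℂ] T₀.graph := ContinuousLinearEquiv.equivOfInverse
    ((s ∘L T.graph.subtypeL).codRestrict T₀.graph fun p => (hg p.1.1 p.1.2).mp p.2)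
    ((s' ∘L T₀.graph.subtypeL).codRestrict T.graph fun p => (hg _ _).mpr (by
      have : (p.1.1, p.1.2 + V p.1.1 - V p.1.1) = p.1 := by simp
      exact this ▸ p.2))
    (fun p => Subtype.ext (Prod.ext rfl (sub_add_cancel p.1.2 (V p.1.1))))
    (fun p => Subtype.ext (Prod.ext rfl (add_sub_cancel_right p.1.2 (V p.1.1))))
  refine ContinuousLinearMap.IsFredholm.of_isQuasiInverse
    (v := (Φ.symm : T₀.graph →L[ℂ] T.graph) ∘L v) ?_
  have h1 : (T.subScalarGraph z : T.graph →ₗ[ℂ] E) =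
      (((e : T₀.graph →L[ℂ] E) + V ∘L (ContinuousLinearMap.fst ℂ E E) ∘L T₀.graph.subtypeL :
        T₀.graph →L[ℂ] E) : T₀.graph →ₗ[ℂ] E) ∘ₗ Φ.toLinearEquiv.toLinearMap := by
    ext p
    change p.1.2 - z • p.1.1 = p.1.2 - V p.1.1 - z • p.1.1 + V p.1.1
    abel
  rw [h1]
  exact Φ.toLinearEquiv.isQuasiInverse.comp hv

/-- An operator with an orthogonal sequence of approximate eigenvectors is not Fredholm: if
`v (T - z) = 1 + N` with `N` of finite rank, then the normalized sequence `g` equals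
`v (T - z) g - N g`, so it has a convergent subsequence. -/
theorem not_isFredholm_of_orthogonal {H : Type*} [NormedAddCommGroup H] [InnerProductSpace ℂ H]
    {T : H →ₗ.[ℂ] H} {z : ℂ} {f l : ℕ → H}
    (hfl : ∀ n, (f n, l n) ∈ T.graph) (hf : ∀ n, f n ≠ 0)
    (horth : ∀ m n, m ≠ n → inner ℂ (f m) (f n) = 0)
    (hle : ∀ ε > 0, ∀ᶠ n in atTop, ‖l n - z • f n‖ ≤ ε * ‖f n‖) :
    ¬ (T.subScalarGraph z).IsFredholm := by
  intro hF
  obtain ⟨v, hv⟩ := hF.exists_isQuasiInverse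
  set B := T.subScalarGraph z with hB
  let N : T.graph →L[ℂ] T.graph := v ∘L B - ContinuousLinearMap.id ℂ _
  have hN : (N : T.graph →ₗ[ℂ] T.graph).HasNoetherianRange :=
    LinearMap.FiniteRangeSetoid.equiv_iff_hasNoetherianRange.mp hv.1
  have hfin : FiniteDimensional ℂ (LinearMap.range (N : T.graph →ₗ[ℂ] T.graph)) := by
    have := hN.isNoetherian_range
    infer_instance
  have hprop : ProperSpace (LinearMap.range (N : T.graph →ₗ[ℂ] T.graph)) :=
    FiniteDimensional.proper ℂ (LinearMap.range (N : T.graph →ₗ[ℂ] T.graph))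
  let c : ℕ → ℂ := fun n => ((‖f n‖⁻¹ : ℝ) : ℂ)
  let g : ℕ → T.graph := fun n => c n • ⟨(f n, l n), hfl n⟩
  have hpos : ∀ n, 0 < ‖f n‖ := fun n => norm_pos_iff.mpr (hf n)
  have hc : ∀ n, ‖c n‖ = ‖f n‖⁻¹ := fun n => by
    rw [Complex.norm_real, norm_inv, norm_norm]
  have hg1 : ∀ n, ‖(g n).1.1‖ = 1 := fun n => by
    change ‖c n • f n‖ = 1
    rw [norm_smul, hc, inv_mul_cancel₀ (hpos n).ne']
  have hBg : Tendsto (fun n => B (g n)) atTop (𝓝 0) := by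
    refine Metric.tendsto_nhds.mpr fun ε hε => ?_
    filter_upwards [hle (ε / 2) (half_pos hε)] with n hn
    rw [dist_zero_right]
    refine lt_of_le_of_lt ?_ (half_lt_self hε)
    change ‖B (c n • ⟨(f n, l n), hfl n⟩)‖ ≤ ε / 2
    rw [_root_.map_smul, norm_smul, hc, inv_mul_le_iff₀ (hpos n), mul_comm]
    exact hn
  obtain ⟨C, hC⟩ := (Metric.isBounded_range_of_tendsto _ hBg).exists_norm_le
  have hgb : ∀ n, ‖g n‖ ≤ max 1 (C + ‖z‖) := fun n => by
    refine max_le_max (hg1 n).le ?_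
    have h1 : ‖B (g n)‖ ≤ C := hC _ ⟨n, rfl⟩
    have h2 : (g n).1.2 = B (g n) + z • (g n).1.1 := by
      rw [hB, subScalarGraph_apply, sub_add_cancel]
    calc ‖(g n).1.2‖ = ‖B (g n) + z • (g n).1.1‖ := congrArg _ h2
      _ ≤ ‖B (g n)‖ + ‖z • (g n).1.1‖ := norm_add_le _ _
      _ ≤ C + ‖z‖ := by rw [norm_smul, hg1, mul_one]; gcongr
  let y : ℕ → LinearMap.range (N : T.graph →ₗ[ℂ] T.graph) := fun n => ⟨N (g n), ⟨g n, rfl⟩⟩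
  have hyb : Bornology.IsBounded (Set.range y) := by
    refine Bornology.isBounded_image_subtype_val.mp
      (isBounded_iff_forall_norm_le.mpr ⟨‖N‖ * max 1 (C + ‖z‖), ?_⟩)
    rintro _ ⟨_, ⟨n, rfl⟩, rfl⟩
    exact (N.le_opNorm _).trans (by gcongr; exact hgb n)
  obtain ⟨a, -, φ, hφ, hlim⟩ := tendsto_subseq_of_bounded hyb (fun n => Set.mem_range_self n)
  have hconv : Tendsto (fun n => (g (φ n)).1.1) atTop (𝓝 ((v 0 - a.1).1.1)) := by
    have h1 : Tendsto (fun n => v (B (g (φ n))) - N (g (φ n))) atTop (𝓝 (v 0 - a.1)) :=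
      ((v.continuous.tendsto _).comp (hBg.comp hφ.tendsto_atTop)).sub
        ((continuous_subtype_val.tendsto _).comp hlim)
    have h2 : ∀ p, v (B p) - N p = p := fun p => by
      change v (B p) - (v (B p) - p) = p
      abel
    simp only [h2] at h1
    exact ((continuous_fst.comp continuous_subtype_val).tendsto _).comp h1
  obtain ⟨n₀, hn₀⟩ := Metric.cauchySeq_iff.mp hconv.cauchySeq 1 one_pos
  have h1 := hn₀ n₀ le_rfl (n₀ + 1) (Nat.le_succ _)
  have hne : φ n₀ ≠ φ (n₀ + 1) := (hφ (Nat.lt_succ_self _)).ne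
  have h2 : inner ℂ (g (φ n₀)).1.1 (g (φ (n₀ + 1))).1.1 = 0 := by
    change inner ℂ (c _ • f _) (c _ • f _) = 0
    rw [inner_smul_left, inner_smul_right, horth _ _ hne, mul_zero, mul_zero]
  have h3 := norm_sub_sq (𝕜 := ℂ) (g (φ n₀)).1.1 (g (φ (n₀ + 1))).1.1
  rw [h2, hg1, hg1] at h3
  rw [dist_eq_norm] at h1
  simp at h3
  nlinarith [norm_nonneg ((g (φ n₀)).1.1 - (g (φ (n₀ + 1))).1.1)]

end LinearPMap

namespace NLDirac
open Filter Topology ComplexConjugate LinearPMap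
open scoped BoundedContinuousFunction

/-! ### Relative compactness of decaying potentials -/

/-- The step function on `[-R, R)` with mesh `d` and values `c`.  For `2R ≤ n d` the index
`⌊(x + R) / d⌋` stays below `n + 1` on this interval, so its reduction by `Fin.ofNat` has no
effect. -/
noncomputable def stepFun (R d : ℝ) (n : ℕ) (c : Fin (n + 1) → Spin) : ℝ → Spin :=
  (Set.Ico (-R) R).indicator fun x => c (Fin.ofNat (n + 1) ⌊(x + R) / d⌋₊)

theorem memLp_stepFun (R d : ℝ) (n : ℕ) (c : Fin (n + 1) → Spin) :
    MemLp (stepFun R d n c) 2 volume := by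
  unfold stepFun
  rw [memLp_indicator_iff_restrict measurableSet_Ico]
  have hm : Measurable fun x : ℝ => c (Fin.ofNat (n + 1) ⌊(x + R) / d⌋₊) := by
    have h1 : Measurable fun x : ℝ => ⌊(x + R) / d⌋₊ :=
      Nat.measurable_floor.comp ((measurable_id.add_const R).div_const d)
    exact (measurable_from_top (f := fun m : ℕ => c (Fin.ofNat (n + 1) m))).comp h1
  have : IsFiniteMeasure (volume.restrict (Set.Ico (-R) R)) := ⟨by simp⟩
  exact MemLp.of_bound hm.aestronglyMeasurable ‖c‖
    (Eventually.of_forall fun x => norm_le_pi_norm _ _)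

/-- The linear map sending a tuple of values to the step function with these values. -/
noncomputable def stepMap (R d : ℝ) (n : ℕ) : (Fin (n + 1) → Spin) →ₗ[ℂ] L2C2 where
  toFun c := (memLp_stepFun R d n c).toLp _
  map_add' c c' := by
    rw [← MemLp.toLp_add]
    refine MemLp.toLp_congr _ _ (Eventually.of_forall fun x => ?_)
    simp only [stepFun, Pi.add_apply]
    exact congrFun (Set.indicator_add _ _ _) x
  map_smul' a c := by
    rw [RingHom.id_apply, ← MemLp.toLp_const_smul]
    refine MemLp.toLp_congr _ _ (Eventually.of_forall fun x => ?_)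
    simp only [stepFun, Pi.smul_apply]
    exact congrFun (Set.indicator_const_smul _ _ _) x

theorem norm_le_of_ae_le_add_indicator {f k : L2C2} {ε c R : ℝ} (hε : 0 ≤ ε) (hc : 0 ≤ c)
    (hR : 0 ≤ R)
    (H : ∀ᵐ x, ‖k x‖ ≤ ε * ‖f x‖ + (Set.Ico (-R) R).indicator (fun _ => c) x) :
    ‖k‖ ≤ ε * ‖f‖ + c * √(2 * R) := by
  have hμ : volume (Set.Ico (-R) R) ≠ ∞ := by simp
  let a : Lp ℝ 2 (volume : Measure ℝ) := ((Lp.memLp f).norm.const_mul ε).toLp _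
  let b : Lp ℝ 2 (volume : Measure ℝ) := indicatorConstLp 2 measurableSet_Ico hμ c
  have h1 : ‖k‖ ≤ ‖a + b‖ := by
    refine Lp.norm_le_norm_of_ae_le ?_
    filter_upwards [H, Lp.coeFn_add a b, ((Lp.memLp f).norm.const_mul ε).coeFn_toLp,
      indicatorConstLp_coeFn (p := 2) (hs := measurableSet_Ico) (hμs := hμ) (c := c)]
      with x h1 h2 h3 h4
    rw [h2, Pi.add_apply, h3, h4]
    exact h1.trans (le_abs_self _)
  have h2 : ‖a‖ ≤ ε * ‖f‖ := by
    refine Lp.norm_le_mul_norm_of_ae_le_mul ?_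
    filter_upwards [((Lp.memLp f).norm.const_mul ε).coeFn_toLp] with x hx
    rw [hx, norm_mul, norm_norm, Real.norm_of_nonneg hε]
  have h3 : ‖b‖ = c * √(2 * R) := by
    rw [norm_indicatorConstLp (by simp) (by simp), Real.norm_of_nonneg hc, Real.sqrt_eq_rpow]
    congr 2
    simp [Measure.real, hR, two_mul]
  linarith [norm_add_le a b]

/-- Multiplication by a decaying matrix-valued function is relatively compact with respect to the
derivative: `H¹` functions are Hölder continuous of exponent `1/2`, so on a bounded interval they
are uniformly approximated by step functions with a fixed partition. -/
theorem mulCLM_comp_mem_closure_finiteRank {X : Type*} [NormedAddCommGroup X] [NormedSpace ℂ X]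
    {A : ℝ →ᵇ (Spin →L[ℂ] Spin)} (hA : ∀ ε > 0, ∃ R, ∀ x, R ≤ |x| → ‖A x‖ ≤ ε)
    {i j : X →L[ℂ] L2C2} (hij : ∀ x, IsWeakDeriv (i x) (j x)) :
    mulCLM A ∘L i ∈ (finiteRankCLM X L2C2).topologicalClosure := by
  refine Metric.mem_closure_iff.mpr fun ε hε => ?_
  -- `R` makes the contribution of `|x| ≥ R` small, and the mesh `d = t²` makes an `H¹` function
  -- oscillate by at most `t ‖j x‖` on each interval of the partition.
  obtain ⟨R₀, hR₀⟩ := hA (ε / 4 / (‖i‖ + 1)) (by positivity)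
  set R := max R₀ 1 with hR
  have hRpos : 0 < R := lt_of_lt_of_le one_pos (le_max_right _ _)
  set t := ε / 4 / (‖A‖ * ‖j‖ * √(2 * R) + 1) with ht
  have htpos : 0 < t := by positivity
  set d := t ^ 2 with hd
  have hdpos : 0 < d := by positivity
  obtain ⟨n, hn⟩ := exists_nat_ge (2 * R / d)
  let S : Submodule ℂ L2C2 := LinearMap.range ((mulCLM A : L2C2 →ₗ[ℂ] L2C2) ∘ₗ stepMap R d n)
  have hSc : CompleteSpace S := FiniteDimensional.complete ℂ S
  have key : ∀ x, ∃ s ∈ S, ‖mulCLM A (i x) - s‖ ≤ ε / 2 * ‖x‖ := by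
    intro x
    obtain ⟨F, -, hfF, hF⟩ := (hij x).exists_continuous_rep
    let c : Fin (n + 1) → Spin := fun m => F (-R + m * d)
    refine ⟨_, ⟨c, rfl⟩, ?_⟩
    have hb : ‖mulCLM A (i x) - mulCLM A (stepMap R d n c)‖ ≤
        (ε / 4 / (‖i‖ + 1)) * ‖i x‖ + (‖A‖ * (t * ‖j x‖)) * √(2 * R) := by
      refine norm_le_of_ae_le_add_indicator (by positivity) (by positivity) hRpos.le ?_
      filter_upwards [Lp.coeFn_sub (mulCLM A (i x)) (mulCLM A (stepMap R d n c)),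
        coeFn_mulCLM A (i x), coeFn_mulCLM A (stepMap R d n c),
        (memLp_stepFun R d n c).coeFn_toLp, hfF] with y h1 h2 h3 h4 h5
      rw [h1, Pi.sub_apply, h2, h3]
      change ‖A y (i x y) - A y ((memLp_stepFun R d n c).toLp _ y)‖ ≤ _
      rw [h4, stepFun]
      by_cases hy : y ∈ Set.Ico (-R) R
      · rw [Set.indicator_of_mem hy, Set.indicator_of_mem hy, ← _root_.map_sub, h5]
        set m := ⌊(y + R) / d⌋₊ with hm
        have hq : 0 ≤ (y + R) / d := div_nonneg (by linarith [hy.1]) hdpos.le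
        have hm1 : (m : ℝ) ≤ (y + R) / d := Nat.floor_le hq
        have hm2 : (y + R) / d < m + 1 := Nat.lt_floor_add_one _
        have hmn : m < n + 1 := by
          have : (m : ℝ) ≤ n := hm1.trans (le_trans (by gcongr; linarith [hy.2]) hn)
          exact Nat.lt_succ_of_le (by exact_mod_cast this)
        have hval : ((Fin.ofNat (n + 1) m : Fin (n + 1)) : ℕ) = m := by
          simp [Fin.ofNat, Nat.mod_eq_of_lt hmn]
        rw [le_div_iff₀ hdpos] at hm1
        rw [div_lt_iff₀ hdpos] at hm2
        have hF' : ‖F y - c (Fin.ofNat (n + 1) m)‖ ≤ t * ‖j x‖ := by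
          change ‖F y - F (-R + ((Fin.ofNat (n + 1) m : Fin (n + 1)) : ℕ) * d)‖ ≤ _
          rw [hval, hF]
          refine (norm_intervalIntegral_coeFn_le _ _ _).trans ?_
          gcongr
          refine Real.sqrt_le_iff.mpr ⟨htpos.le, ?_⟩
          rw [abs_of_nonneg (by linarith)]
          linarith
        have := ((A y).le_opNorm (F y - c (Fin.ofNat (n + 1) m))).trans
          (mul_le_mul (A.norm_coe_le_norm y) hF' (norm_nonneg _) (norm_nonneg _))
        have h0 : 0 ≤ ε / 4 / (‖i‖ + 1) * ‖F y‖ := by positivity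
        linarith
      · rw [Set.indicator_of_notMem hy, Set.indicator_of_notMem hy, _root_.map_zero, sub_zero,
          add_zero]
        have hy' : R ≤ |y| := by
          by_contra hlt
          rw [not_le, abs_lt] at hlt
          exact hy ⟨hlt.1.le, hlt.2⟩
        exact (A y).le_of_opNorm_le (hR₀ y ((le_max_left _ _).trans hy')) _
    refine hb.trans ?_
    have h1 : ε / 4 / (‖i‖ + 1) * ‖i x‖ ≤ ε / 4 * ‖x‖ := by
      have := i.le_opNorm x
      rw [div_mul_eq_mul_div, div_le_iff₀ (by positivity)]
      have h0 := norm_nonneg x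
      nlinarith
    have h2 : ‖A‖ * (t * ‖j x‖) * √(2 * R) ≤ ε / 4 * ‖x‖ := by
      have h3 : ‖A‖ * (t * ‖j x‖) * √(2 * R) ≤ t * (‖A‖ * ‖j‖ * √(2 * R)) * ‖x‖ := by
        calc ‖A‖ * (t * ‖j x‖) * √(2 * R) ≤ ‖A‖ * (t * (‖j‖ * ‖x‖)) * √(2 * R) := by
              gcongr; exact j.le_opNorm x
          _ = _ := by ring
      refine h3.trans ?_
      gcongr
      rw [ht, div_mul_eq_mul_div, div_le_iff₀ (by positivity)]
      nlinarith
    linarith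
  -- The step functions depend only on `R`, `d` and `n`, so the projection onto their image under
  -- multiplication by `A` is an approximation of finite rank.
  refine ⟨S.starProjection ∘L mulCLM A ∘L i, ?_, ?_⟩
  · change LinearMap.HasNoetherianRange _
    have : IsNoetherian ℂ S := inferInstance
    refine isNoetherian_of_le (t := S) ?_
    rintro _ ⟨x, rfl⟩
    exact Submodule.starProjection_apply_mem S _
  · rw [dist_eq_norm]
    refine lt_of_le_of_lt (ContinuousLinearMap.opNorm_le_bound _ (by positivity) fun x => ?_)
      (half_lt_self hε)
    obtain ⟨s, hs, hle⟩ := key x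
    refine le_trans ?_ hle
    change ‖mulCLM A (i x) - S.starProjection (mulCLM A (i x))‖ ≤ _
    rw [Submodule.starProjection_minimal]
    exact ciInf_le ⟨0, by rintro _ ⟨y, rfl⟩; positivity⟩ (⟨s, hs⟩ : S)

end NLDirac

namespace NLDirac
open Filter Topology ComplexConjugate
open LinearPMap (finiteRankCLM)
open scoped BoundedContinuousFunction

/-! ### The free operator and the Fredholm property off the essential spectrum -/

/-- The matrix `[[1, 0], [0, -1]]`. -/
noncomputable def β : Spin →L[ℂ] Spin :=
  Matrix.toEuclideanCLM (𝕜 := ℂ) (n := Fin 2) !![1, 0; 0, -1]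

theorem β_apply (a : Spin) : β a = !₂[a 0, - a 1] := by
  ext i
  fin_cases i <;> simp [β, Matrix.ofLp_toEuclideanCLM, Matrix.vecHead, Matrix.vecTail]

theorem β_J (a : Spin) : β (J a) = - J (β a) := by
  ext i
  fin_cases i <;> simp [J_apply, β_apply]

theorem inner_β (a b : Spin) : inner ℂ (β a) b = inner ℂ a (β b) := by
  simp [β_apply, PiLp.inner_apply, Fin.sum_univ_two]

theorem β_β (a : Spin) : β (β a) = a := by
  ext i
  fin_cases i <;> simp [β_apply]

theorem norm_β (a : Spin) : ‖β a‖ = ‖a‖ := by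
  have h : inner ℂ (β a) (β a) = inner ℂ a a := by rw [inner_β, β_β]
  rw [inner_self_eq_norm_sq_to_K, inner_self_eq_norm_sq_to_K] at h
  have h' : ‖β a‖ ^ 2 = ‖a‖ ^ 2 := by exact_mod_cast h
  exact (sq_eq_sq₀ (norm_nonneg _) (norm_nonneg _)).mp h'

/-- The limit at infinity of the potentials of `ℋ₋` and `ℋ₊`. -/
noncomputable def limitPot (ω : ℝ) : Matrix (Fin 2) (Fin 2) ℂ :=
  !![1 - (ω : ℂ), 0; 0, -1 - (ω : ℂ)]

theorem toEuclideanCLM_limitPot (ω : ℝ) (a : Spin) :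
    Matrix.toEuclideanCLM (𝕜 := ℂ) (limitPot ω) a = β a - (ω : ℂ) • a := by
  ext i
  fin_cases i <;>
    simp [β_apply, limitPot, Matrix.ofLp_toEuclideanCLM, Matrix.vecHead, Matrix.vecTail] <;> ring

/-- The constant potential `limitPot ω` as a bounded continuous function. -/
noncomputable def limitBCF (ω : ℝ) : ℝ →ᵇ (Spin →L[ℂ] Spin) :=
  BoundedContinuousFunction.const ℝ (Matrix.toEuclideanCLM (𝕜 := ℂ) (limitPot ω))

theorem limitBCF_apply (ω x : ℝ) :
    limitBCF ω x = Matrix.toEuclideanCLM (𝕜 := ℂ) (limitPot ω) := rfl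

/-- The free operator `ℋ = [[1 - ω, ∂_x], [-∂_x, -1 - ω]]`. -/
noncomputable def freeOp (ω : ℝ) : L2C2 →ₗ.[ℂ] L2C2 := diracOp fun _ => limitPot ω

theorem isGraphSelfAdjoint_freeOp (ω : ℝ) : IsGraphSelfAdjoint (freeOp ω) := by
  refine isGraphSelfAdjoint_diracOp (A := limitBCF ω) (limitBCF_apply ω) fun x a b => ?_
  rw [limitBCF_apply, toEuclideanCLM_limitPot, toEuclideanCLM_limitPot, inner_sub_left,
    inner_sub_right, inner_β, inner_smul_left, inner_smul_right, Complex.conj_ofReal]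

/-- The spectral gap of the free Dirac operator: since `J ∂_x` and `β` anticommute,
`‖(J ∂_x + β) f‖² = ‖∂_x f‖² + ‖f‖²`. -/
theorem freeOp_gap {ω : ℝ} (hω0 : 0 < ω) {f k : L2C2} (hfk : (f, k) ∈ (freeOp ω).graph) :
    (1 - ω) * ‖f‖ ≤ ‖k‖ := by
  obtain ⟨h, hf, rfl⟩ := (mem_graph_diracOp (limitBCF_apply ω)).mp hfk
  set b := β.compLpL 2 (volume : Measure ℝ) with hb
  have e1 : mulCLM (limitBCF ω) f = b f - (ω : ℂ) • f := by
    refine Lp.ext ?_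
    filter_upwards [coeFn_mulCLM (limitBCF ω) f, β.coeFn_compLpL (p := 2) f,
      Lp.coeFn_sub (b f) ((ω : ℂ) • f), Lp.coeFn_smul (ω : ℂ) f] with x h1 h2 h3 h4
    rw [h1, h3, Pi.sub_apply, h2, h4, limitBCF_apply, toEuclideanCLM_limitPot, Pi.smul_apply]
  have hbnorm : ‖b f‖ = ‖f‖ := by
    refine le_antisymm ?_ ?_ <;> refine Lp.norm_le_norm_of_ae_le ?_ <;>
      filter_upwards [β.coeFn_compLpL (p := 2) f] with x hx <;> rw [hx, norm_β]
  have hbJ : ∀ k : L2C2, b (JL k) = - JL (b k) := fun k => by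
    refine Lp.ext ?_
    filter_upwards [β.coeFn_compLpL (p := 2) (JL k), J.coeFn_compLpL (p := 2) k,
      J.coeFn_compLpL (p := 2) (b k), β.coeFn_compLpL (p := 2) k,
      Lp.coeFn_neg (JL (b k))] with x h1 h2 h3 h4 h5
    rw [h1, h2, h5, Pi.neg_apply, h3, h4, β_J]
  have hbi : ∀ p q : L2C2, inner ℂ (b p) q = inner ℂ p (b q) := fun p q => by
    rw [L2.inner_def, L2.inner_def]
    refine integral_congr_ae ?_
    filter_upwards [β.coeFn_compLpL (p := 2) p, β.coeFn_compLpL (p := 2) q] with x h1 h2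
    rw [h1, h2, inner_β]
  have hbw : IsWeakDeriv (b f) (b h) := hf.compLp β
  -- The cross term in `‖J ∂_x f + β f‖²` vanishes.
  have hX : (inner ℂ (JL h) (b f)).re = 0 := by
    have i1 : inner ℂ (JL h) (b f) = - inner ℂ h (JL (b f)) := inner_JL _ _
    have i2 : inner ℂ h (JL (b f)) = - inner ℂ f (JL (b h)) := hf.inner_eq_neg hbw.JL
    have i3 : inner ℂ f (JL (b h)) = inner ℂ (JL (b f)) h := by
      have j1 := inner_JL f (b h)
      rw [← hbi, hbJ, inner_neg_left, neg_inj] at j1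
      exact j1.symm
    have i4 : inner ℂ (JL (b f)) h = conj (inner ℂ h (JL (b f))) := (inner_conj_symm _ _).symm
    rw [i3, i4] at i2
    have i5 := congrArg Complex.re i2
    rw [Complex.neg_re, Complex.conj_re] at i5
    rw [i1, Complex.neg_re]
    linarith
  have hD : ‖f‖ ≤ ‖JL h + b f‖ := by
    refine le_of_sq_le_sq ?_ (norm_nonneg _)
    rw [norm_add_sq (𝕜 := ℂ)]
    change _ ≤ _ + 2 * (inner ℂ (JL h) (b f)).re + _
    rw [hX, hbnorm]
    nlinarith [sq_nonneg ‖JL h‖]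
  rw [e1, ← add_sub_assoc]
  have := norm_sub_norm_le (JL h + b f) ((ω : ℂ) • f)
  rw [norm_smul, Complex.norm_real, Real.norm_of_nonneg hω0.le] at this
  linarith

/-- The conditions on a potential `M` which enter the spectral analysis: it is Hermitian and
continuous and tends to `limitPot ω` at infinity.  The function `A` is `M` as a bounded
continuous function with values in the operators on the fibre. -/
structure IsAsymptoticPot (ω : ℝ) (M : ℝ → Matrix (Fin 2) (Fin 2) ℂ)
    (A : ℝ →ᵇ (Spin →L[ℂ] Spin)) : Prop where
  apply_eq : ∀ x, A x = Matrix.toEuclideanCLM (𝕜 := ℂ) (M x)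
  symm : ∀ x a b, inner ℂ (A x a) b = inner ℂ a (A x b)
  decay : ∀ ε > 0, ∃ R, ∀ x, R ≤ |x| → ‖(A - limitBCF ω) x‖ ≤ ε

/-- Norm limits of finite rank operators are stable under composition on the left. -/
theorem comp_mem_closure_finiteRank {X Y Z : Type*} [NormedAddCommGroup X] [NormedSpace ℂ X]
    [NormedAddCommGroup Y] [NormedSpace ℂ Y] [NormedAddCommGroup Z] [NormedSpace ℂ Z]
    (L : Y →L[ℂ] Z) {C : X →L[ℂ] Y} (hC : C ∈ (finiteRankCLM X Y).topologicalClosure) :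
    L ∘L C ∈ (finiteRankCLM X Z).topologicalClosure := by
  refine map_mem_closure (f := fun C : X →L[ℂ] Y => L ∘L C) (by fun_prop) hC fun F hF => ?_
  exact LinearMap.HasNoetherianRange.comp_left hF (L : Y →ₗ[ℂ] Z)

section Fredholm

variable {ω : ℝ} {M N : ℝ → Matrix (Fin 2) (Fin 2) ℂ} {A B : ℝ →ᵇ (Spin →L[ℂ] Spin)}

theorem IsAsymptoticPot.isGraphSelfAdjoint (hA : IsAsymptoticPot ω M A) :
    IsGraphSelfAdjoint (diracOp M) :=
  isGraphSelfAdjoint_diracOp hA.apply_eq hA.symm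

/-- A Dirac operator is a perturbation of the free one by the bounded operator of multiplication
by `M - limitPot ω`. -/
theorem IsAsymptoticPot.mem_graph_iff (hA : IsAsymptoticPot ω M A) {f k : L2C2} :
    (f, k) ∈ (diracOp M).graph ↔ (f, k - mulCLM (A - limitBCF ω) f) ∈ (freeOp ω).graph := by
  rw [freeOp, mem_graph_diracOp hA.apply_eq, mem_graph_diracOp (limitBCF_apply ω)]
  refine exists_congr fun h => and_congr_right fun _ => ?_
  rw [mulCLM_sub, sub_apply (mulCLM A), sub_eq_iff_eq_add]
  simp

/-- The difference of `[[0, ℋ₋], [-ℋ₊, 0]]` and its free counterpart. -/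
noncomputable def blockPot (A B : ℝ →ᵇ (Spin →L[ℂ] Spin)) : L2C4 →L[ℂ] L2C4 :=
  ((WithLp.prodContinuousLinearEquiv 2 ℂ L2C2 L2C2).symm : L2C2 × L2C2 →L[ℂ] L2C4) ∘L
    (((mulCLM A) ∘L ContinuousLinearMap.snd ℂ L2C2 L2C2).prod
      (-((mulCLM B) ∘L ContinuousLinearMap.fst ℂ L2C2 L2C2))) ∘L
    ((WithLp.prodContinuousLinearEquiv 2 ℂ L2C2 L2C2) : L2C4 →L[ℂ] L2C2 × L2C2)

theorem blockPot_apply (A B : ℝ →ᵇ (Spin →L[ℂ] Spin)) (f : L2C4) :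
    blockPot A B f = WithLp.toLp 2 (mulCLM A f.snd, -mulCLM B f.fst) := rfl

/-- Off the two half-lines, the block operator is Fredholm. -/
theorem isFredholm_blockOp (hω0 : 0 < ω) (hω1 : ω < 1) (hA : IsAsymptoticPot ω M A)
    (hB : IsAsymptoticPot ω N B) {z : ℂ} (hz : ¬ (z.re = 0 ∧ 1 - ω ≤ |z.im|)) :
    ((blockOp (diracOp M) (diracOp N)).subScalarGraph z).IsFredholm := by
  have hS := isGraphSelfAdjoint_freeOp ω
  have hcl := isClosed_graph_blockOp hS hS
  refine LinearPMap.isFredholm_of_perturbation (T₀ := blockOp (freeOp ω) (freeOp ω))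
    (V := blockPot (A - limitBCF ω) (B - limitBCF ω)) (fun f k => ?_) hcl
    (bijective_subScalarGraph_blockOp hS (sub_pos.mpr hω1) (fun f k h => freeOp_gap hω0 h) hz) ?_
  · rw [mem_graph_blockOp, mem_graph_blockOp, hA.mem_graph_iff, hB.mem_graph_iff, blockPot_apply]
    simp [sub_eq_add_neg, add_comm]
  · set X := (blockOp (freeOp ω) (freeOp ω)).graph with hX
    let e : L2C4 →L[ℂ] L2C2 × L2C2 := (WithLp.prodContinuousLinearEquiv 2 ℂ L2C2 L2C2)
    let e' : L2C2 × L2C2 →L[ℂ] L2C4 := (WithLp.prodContinuousLinearEquiv 2 ℂ L2C2 L2C2).symm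
    let p : X →L[ℂ] L2C2 × L2C2 := e ∘L ContinuousLinearMap.fst ℂ L2C4 L2C4 ∘L X.subtypeL
    let q : X →L[ℂ] L2C2 × L2C2 := e ∘L ContinuousLinearMap.snd ℂ L2C4 L2C4 ∘L X.subtypeL
    let i₁ : X →L[ℂ] L2C2 := ContinuousLinearMap.fst ℂ L2C2 L2C2 ∘L p
    let i₂ : X →L[ℂ] L2C2 := ContinuousLinearMap.snd ℂ L2C2 L2C2 ∘L p
    let k₁ : X →L[ℂ] L2C2 := ContinuousLinearMap.fst ℂ L2C2 L2C2 ∘L q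
    let k₂ : X →L[ℂ] L2C2 := -(ContinuousLinearMap.snd ℂ L2C2 L2C2 ∘L q)
    -- On the graph of the free operator, the derivative `-J (k - limitPot ω f)` is bounded in the
    -- graph norm.
    have hweak : ∀ {f k : L2C2}, (f, k) ∈ (freeOp ω).graph →
        IsWeakDeriv f (-JL (k - mulCLM (limitBCF ω) f)) := by
      intro f k hfk
      obtain ⟨h, hf, rfl⟩ := (mem_graph_diracOp (limitBCF_apply ω)).mp hfk
      rw [add_sub_cancel_right, JL_JL, neg_neg]
      exact hf
    have c₂ : mulCLM (A - limitBCF ω) ∘L i₂ ∈ (finiteRankCLM X L2C2).topologicalClosure :=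
      mulCLM_comp_mem_closure_finiteRank hA.decay
        (j := -(JL ∘L (k₁ - mulCLM (limitBCF ω) ∘L i₂)))
        fun x => hweak (mem_graph_blockOp.mp x.2).1
    have c₁ : mulCLM (B - limitBCF ω) ∘L i₁ ∈ (finiteRankCLM X L2C2).topologicalClosure :=
      mulCLM_comp_mem_closure_finiteRank hB.decay
        (j := -(JL ∘L (k₂ - mulCLM (limitBCF ω) ∘L i₁)))
        fun x => hweak (mem_graph_blockOp.mp x.2).2
    have h1 := Submodule.sub_mem _
      (comp_mem_closure_finiteRank (e' ∘L ContinuousLinearMap.inl ℂ L2C2 L2C2) c₂)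
      (comp_mem_closure_finiteRank (e' ∘L ContinuousLinearMap.inr ℂ L2C2 L2C2) c₁)
    convert h1 using 1
    ext1 x
    refine WithLp.ofLp_injective 2 (Prod.ext ?_ ?_)
    · exact (sub_zero _).symm
    · exact (zero_sub _).symm

end Fredholm

end NLDirac

namespace NLDirac
open Filter Topology ComplexConjugate
open scoped BoundedContinuousFunction

/-! ### Weyl sequences on the essential spectrum -/

theorem norm_le_mul_sqrt_of_ae_le_indicator {f : L2C2} {c p q : ℝ} (hc : 0 ≤ c) (hpq : p ≤ q)
    (H : ∀ᵐ x, ‖f x‖ ≤ (Set.Icc p q).indicator (fun _ => c) x) : ‖f‖ ≤ c * √(q - p) := by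
  have hμ : volume (Set.Icc p q) ≠ ∞ := by simp
  let b : Lp ℝ 2 (volume : Measure ℝ) := indicatorConstLp 2 measurableSet_Icc hμ c
  have h1 : ‖f‖ ≤ ‖b‖ := by
    refine Lp.norm_le_norm_of_ae_le ?_
    filter_upwards [H, indicatorConstLp_coeFn (p := 2) (hs := measurableSet_Icc) (hμs := hμ)
      (c := c)] with x h1 h2
    rw [h2]
    exact h1.trans (le_abs_self _)
  refine h1.trans_eq ?_
  rw [norm_indicatorConstLp (by simp) (by simp), Real.norm_of_nonneg hc, Real.sqrt_eq_rpow]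
  congr 2
  simp [Measure.real, hpq]

theorem mul_sqrt_le_norm_of_indicator_ae_le {f : L2C2} {c p q : ℝ} (hc : 0 ≤ c) (hpq : p ≤ q)
    (H : ∀ᵐ x, (Set.Icc p q).indicator (fun _ => c) x ≤ ‖f x‖) : c * √(q - p) ≤ ‖f‖ := by
  have hμ : volume (Set.Icc p q) ≠ ∞ := by simp
  let b : Lp ℝ 2 (volume : Measure ℝ) := indicatorConstLp 2 measurableSet_Icc hμ c
  have h1 : ‖b‖ ≤ ‖f‖ := by
    refine Lp.norm_le_norm_of_ae_le ?_
    filter_upwards [H, indicatorConstLp_coeFn (p := 2) (hs := measurableSet_Icc) (hμs := hμ)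
      (c := c)] with x h1 h2
    rw [h2, Real.norm_of_nonneg (Set.indicator_nonneg (fun _ _ => hc) _)]
    exact h1
  refine le_trans (le_of_eq ?_) h1
  rw [norm_indicatorConstLp (by simp) (by simp), Real.norm_of_nonneg hc, Real.sqrt_eq_rpow]
  congr 2
  simp [Measure.real, hpq]

/-- For `1 ≤ d`, the plane wave `e^{iκx} w` with `κ² = d² - 1` solves the free Dirac equation
`(J ∂_x + β) ρ = d ρ`. -/
theorem exists_planeWave {d : ℝ} (hd : 1 ≤ d) :
    ∃ (κ : ℝ) (w : Spin), w ≠ 0 ∧ (Complex.I * κ) • J w + β w = (d : ℂ) • w := by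
  have hκ : ((√(d ^ 2 - 1) : ℝ) : ℂ) ^ 2 = (d : ℂ) ^ 2 - 1 := by
    rw [← Complex.ofReal_pow, Real.sq_sqrt (by nlinarith)]
    push_cast
    ring
  refine ⟨√(d ^ 2 - 1), !₂[(d : ℂ) + 1, -(Complex.I * √(d ^ 2 - 1))], fun h => ?_, ?_⟩
  · have h0 := congrArg (fun a : Spin => (a 0).re) h
    simp at h0
    linarith
  · ext i
    fin_cases i
    · simp only [J_apply, β_apply]
      simp
      linear_combination (-Complex.I ^ 2) * hκ - ((d : ℂ) ^ 2 - 1) * Complex.I_sq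
    · simp only [J_apply, β_apply]
      simp
      ring

/-- The bump function which is `1` on `[-1, 1]` and supported in `[-2, 2]`. -/
noncomputable def cutoff : ContDiffBump (0 : ℝ) := ⟨1, 2, one_pos, one_lt_two⟩

theorem cutoff_eq_one {x : ℝ} (hx : |x| ≤ 1) : cutoff x = 1 :=
  cutoff.one_of_mem_closedBall (by simpa [cutoff] using hx)

theorem cutoff_eq_zero {x : ℝ} (hx : 2 ≤ |x|) : cutoff x = 0 :=
  cutoff.zero_of_le_dist (by simpa [cutoff] using hx)

theorem hasDerivAt_cutoff (x : ℝ) : HasDerivAt cutoff (deriv cutoff x) x :=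
  ((cutoff.contDiff (n := 1)).differentiable one_ne_zero x).hasDerivAt

theorem deriv_cutoff_eq_zero {x : ℝ} (hx : 2 < |x|) : deriv cutoff x = 0 := by
  have : (cutoff : ℝ → ℝ) =ᶠ[𝓝 x] fun _ => 0 := by
    filter_upwards [continuous_abs.continuousAt.eventually (lt_mem_nhds hx)] with y hy
    exact cutoff_eq_zero hy.le
  rw [this.deriv_eq, deriv_const]

theorem continuous_deriv_cutoff : Continuous (deriv cutoff) :=
  (cutoff.contDiff (n := 1)).continuous_deriv le_rfl

theorem exists_bound_deriv_cutoff : ∃ K : ℝ, 0 ≤ K ∧ ∀ x, |deriv cutoff x| ≤ K := by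
  obtain ⟨K, hK⟩ := cutoff.hasCompactSupport.deriv.exists_bound_of_continuous
    continuous_deriv_cutoff
  exact ⟨K, (abs_nonneg _).trans (hK 0), hK⟩

/-- The plane wave `e^{iκx} w`, cut off at distance of order `m` from `a`. -/
noncomputable def packet (κ : ℝ) (w : Spin) (a m x : ℝ) : Spin :=
  ((cutoff ((x - a) / m) : ℂ) * Complex.exp (Complex.I * κ * x)) • w

/-- The derivative of `packet`. -/
noncomputable def packetDeriv (κ : ℝ) (w : Spin) (a m x : ℝ) : Spin :=
  ((deriv cutoff ((x - a) / m) / m : ℝ) * Complex.exp (Complex.I * κ * x)) • w +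
    (Complex.I * κ) • packet κ w a m x

section packet

variable (κ : ℝ) (w : Spin) (a : ℝ) {m : ℝ}

theorem hasDerivAt_packet (x : ℝ) :
    HasDerivAt (packet κ w a m) (packetDeriv κ w a m x) x := by
  have h1 : HasDerivAt (fun x : ℝ => (cutoff ((x - a) / m) : ℂ))
      ((deriv cutoff ((x - a) / m) / m : ℝ) : ℂ) x := by
    refine HasDerivAt.ofReal_comp ?_
    have := (hasDerivAt_cutoff ((x - a) / m)).comp x (((hasDerivAt_id x).sub_const a).div_const m)
    rwa [mul_one_div] at this
  have h2 : HasDerivAt (fun x : ℝ => Complex.exp (Complex.I * κ * x))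
      (Complex.exp (Complex.I * κ * x) * (Complex.I * κ)) x := by
    have := ((Complex.ofRealCLM.hasDerivAt (x := x)).const_mul (Complex.I * κ)).cexp
    simpa using this
  refine HasDerivAt.congr_deriv (f := packet κ w a m) ((h1.mul h2).smul_const w) ?_
  rw [packetDeriv, packet, smul_smul, ← add_smul]
  congr 1
  ring

theorem two_lt_abs_div (hm : 0 < m) {x : ℝ} (hx : x ∉ Set.Icc (a - 2 * m) (a + 2 * m)) :
    2 < |(x - a) / m| := by
  rw [abs_div, abs_of_pos hm, lt_div_iff₀ hm]
  by_contra h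
  rw [not_lt, abs_le] at h
  exact hx ⟨by linarith [h.1], by linarith [h.2]⟩

theorem packet_eq_zero (hm : 0 < m) {x : ℝ} (hx : x ∉ Set.Icc (a - 2 * m) (a + 2 * m)) :
    packet κ w a m x = 0 := by
  rw [packet, cutoff_eq_zero (two_lt_abs_div a hm hx).le]
  simp

theorem packetDeriv_eq_zero (hm : 0 < m) {x : ℝ} (hx : x ∉ Set.Icc (a - 2 * m) (a + 2 * m)) :
    packetDeriv κ w a m x = 0 := by
  rw [packetDeriv, packet_eq_zero κ w a hm hx, deriv_cutoff_eq_zero (two_lt_abs_div a hm hx)]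
  simp

theorem norm_exp_I_mul (x : ℝ) : ‖Complex.exp (Complex.I * κ * x)‖ = 1 := by
  rw [show Complex.I * κ * x = ((κ * x : ℝ) : ℂ) * Complex.I by push_cast; ring,
    Complex.norm_exp_ofReal_mul_I]

theorem norm_packet_le (x : ℝ) : ‖packet κ w a m x‖ ≤ ‖w‖ := by
  rw [packet, norm_smul, norm_mul, norm_exp_I_mul, mul_one, Complex.norm_real,
    Real.norm_of_nonneg cutoff.nonneg]
  exact mul_le_of_le_one_left (norm_nonneg _) cutoff.le_one

theorem norm_packet_eq (hm : 0 < m) {x : ℝ} (hx : x ∈ Set.Icc (a - m) (a + m)) :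
    ‖packet κ w a m x‖ = ‖w‖ := by
  have : |(x - a) / m| ≤ 1 := by
    rw [abs_div, abs_of_pos hm, div_le_one hm, abs_le]
    exact ⟨by linarith [hx.1], by linarith [hx.2]⟩
  rw [packet, norm_smul, norm_mul, norm_exp_I_mul, cutoff_eq_one this]
  simp

theorem memLp_packet (hm : 0 < m) : MemLp (packet κ w a m) 2 volume := by
  refine Continuous.memLp_of_hasCompactSupport
    (continuous_iff_continuousAt.mpr fun x => (hasDerivAt_packet κ w a x).continuousAt) ?_
  exact HasCompactSupport.intro isCompact_Icc fun x hx => packet_eq_zero κ w a hm hx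

theorem memLp_packetDeriv (hm : 0 < m) : MemLp (packetDeriv κ w a m) 2 volume := by
  have hc : Continuous (packet κ w a m) :=
    continuous_iff_continuousAt.mpr fun x => (hasDerivAt_packet κ w a x).continuousAt
  refine Continuous.memLp_of_hasCompactSupport ?_ ?_
  · have := continuous_deriv_cutoff
    unfold packetDeriv
    fun_prop
  · exact HasCompactSupport.intro isCompact_Icc fun x hx => packetDeriv_eq_zero κ w a hm hx

end packet

/-- Wave packets with disjoint supports moving to infinity form a Weyl sequence, simultaneously
for all potentials which tend to `limitPot ω` at infinity. -/
theorem exists_weylSequence {ω s : ℝ} (hs : 1 - ω ≤ s) :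
    ∃ P Q : ℕ → L2C2, (∀ n, IsWeakDeriv (P n) (Q n)) ∧ (∀ n, P n ≠ 0) ∧
      (∀ m n, m ≠ n → inner ℂ (P m) (P n) = 0) ∧
      ∀ A : ℝ →ᵇ (Spin →L[ℂ] Spin),
        (∀ ε > 0, ∃ R, ∀ x, R ≤ |x| → ‖(A - limitBCF ω) x‖ ≤ ε) →
        ∀ ε > 0, ∀ᶠ n in atTop,
          ‖JL (Q n) + mulCLM A (P n) - (s : ℂ) • P n‖ ≤ ε * ‖P n‖ := by
  obtain ⟨κ, w, hw, hwave⟩ := exists_planeWave (d := s + ω) (by linarith)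
  obtain ⟨K, hK0, hK⟩ := exists_bound_deriv_cutoff
  have hm : ∀ n : ℕ, (0 : ℝ) < n + 1 := fun n => by positivity
  -- The packets live on `[a - 2m, a + 2m]` with `m = n + 1` and `a = 4m²`.  These intervals are
  -- disjoint and escape to infinity, and their growing length makes the cutoff error small.
  let P : ℕ → L2C2 := fun n => (memLp_packet κ w (4 * (n + 1) ^ 2) (hm n)).toLp _
  let Q : ℕ → L2C2 := fun n => (memLp_packetDeriv κ w (4 * (n + 1) ^ 2) (hm n)).toLp _
  have hP : ∀ n, P n =ᵐ[volume] packet κ w (4 * (n + 1) ^ 2) (n + 1) :=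
    fun n => MemLp.coeFn_toLp _
  have hQ : ∀ n, Q n =ᵐ[volume] packetDeriv κ w (4 * (n + 1) ^ 2) (n + 1) :=
    fun n => MemLp.coeFn_toLp _
  have hlow : ∀ n : ℕ, ‖w‖ * √(2 * (n + 1)) ≤ ‖P n‖ := fun n => by
    have := mul_sqrt_le_norm_of_indicator_ae_le (f := P n) (c := ‖w‖)
      (p := 4 * ((n : ℝ) + 1) ^ 2 - (n + 1)) (q := 4 * ((n : ℝ) + 1) ^ 2 + (n + 1))
      (norm_nonneg _) (by linarith [hm n]) (by
        filter_upwards [hP n] with x hx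
        by_cases hxs : x ∈ Set.Icc (4 * ((n : ℝ) + 1) ^ 2 - (n + 1))
          (4 * ((n : ℝ) + 1) ^ 2 + (n + 1))
        · rw [Set.indicator_of_mem hxs, hx, norm_packet_eq κ w _ (hm n) hxs]
        · rw [Set.indicator_of_notMem hxs]
          exact norm_nonneg _)
    convert this using 3
    ring
  have hdisj : ∀ m n : ℕ, m < n → inner ℂ (P m) (P n) = 0 := fun m n hmn => by
    rw [L2.inner_def]
    refine integral_eq_zero_of_ae ?_
    filter_upwards [hP m, hP n] with x h1 h2
    rw [h1, h2]
    by_cases hx : x ∈ Set.Icc (4 * ((m : ℝ) + 1) ^ 2 - 2 * (m + 1))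
        (4 * ((m : ℝ) + 1) ^ 2 + 2 * (m + 1))
    · have hn : x ∉ Set.Icc (4 * ((n : ℝ) + 1) ^ 2 - 2 * (n + 1))
          (4 * ((n : ℝ) + 1) ^ 2 + 2 * (n + 1)) := fun hx' => by
        have h3 := hx.2
        have h4 := hx'.1
        have h5 : (m : ℝ) + 1 ≤ n := by exact_mod_cast hmn
        have h6 : (0 : ℝ) ≤ m := m.cast_nonneg
        nlinarith
      rw [packet_eq_zero κ w _ (hm n) hn, inner_zero_right]
      rfl
    · rw [packet_eq_zero κ w _ (hm m) hx, inner_zero_left]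
      rfl
  refine ⟨P, Q, fun n => isWeakDeriv_of_hasDerivAt _ _ (hasDerivAt_packet κ w _), fun n h => ?_,
    fun m n hmn => ?_, fun A hA ε hε => ?_⟩
  · have := hlow n
    rw [h, norm_zero] at this
    have h2 : 0 < ‖w‖ * √(2 * (n + 1)) := by positivity
    linarith
  · rcases hmn.lt_or_gt with h | h
    · exact hdisj m n h
    · rw [← inner_conj_symm, hdisj n m h, map_zero]
  · obtain ⟨R, hR⟩ := hA (ε / 4) (by positivity)
    have hw' : 0 < ‖w‖ := norm_pos_iff.mpr hw
    obtain ⟨N, hN⟩ := exists_nat_ge (max R (K * ‖J w‖ / (ε / 4 * ‖w‖)))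
    filter_upwards [eventually_ge_atTop N] with n hn
    have hn' : max R (K * ‖J w‖ / (ε / 4 * ‖w‖)) ≤ n + 1 :=
      hN.trans ((Nat.cast_le.mpr hn).trans (by linarith))
    have hKn : K / (n + 1) * ‖J w‖ ≤ ε / 4 * ‖w‖ := by
      have := (le_max_right _ _).trans hn'
      rw [div_le_iff₀ (by positivity)] at this
      rw [div_mul_eq_mul_div, div_le_iff₀ (hm n)]
      linarith
    -- Both the cutoff error and the error from the potential are bounded by `ε / 4 * ‖w‖`.
    have hub : ‖JL (Q n) + mulCLM A (P n) - (s : ℂ) • P n‖ ≤ (ε / 2 * ‖w‖) * √(4 * (n + 1)) := by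
      have := norm_le_mul_sqrt_of_ae_le_indicator
        (f := JL (Q n) + mulCLM A (P n) - (s : ℂ) • P n) (c := ε / 2 * ‖w‖)
        (p := 4 * ((n : ℝ) + 1) ^ 2 - 2 * (n + 1)) (q := 4 * ((n : ℝ) + 1) ^ 2 + 2 * (n + 1))
        (by positivity) (by linarith [hm n]) (by
          filter_upwards [Lp.coeFn_sub (JL (Q n) + mulCLM A (P n)) ((s : ℂ) • P n),
            Lp.coeFn_add (JL (Q n)) (mulCLM A (P n)), Lp.coeFn_smul (s : ℂ) (P n),
            coeFn_mulCLM A (P n), J.coeFn_compLpL (p := 2) (Q n), hP n, hQ n]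
            with x h1 h2 h3 h4 h5 h6 h7
          rw [h1, Pi.sub_apply, h2, Pi.add_apply, h3, Pi.smul_apply, h4]
          change ‖(J.compLpL 2 volume) (Q n) x + _ - _‖ ≤ _
          rw [h5, h6, h7]
          by_cases hxs : x ∈ Set.Icc (4 * ((n : ℝ) + 1) ^ 2 - 2 * (n + 1))
            (4 * ((n : ℝ) + 1) ^ 2 + 2 * (n + 1))
          · rw [Set.indicator_of_mem hxs]
            have hRx : R ≤ |x| := by
              refine ((le_max_left _ _).trans hn').trans (le_trans ?_ (le_abs_self x))
              have := hxs.1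
              have := n.cast_nonneg (α := ℝ)
              nlinarith
            set ρ := packet κ w (4 * ((n : ℝ) + 1) ^ 2) (n + 1) x with hρ
            have hAx : A x ρ = (A - limitBCF ω) x ρ + (β ρ - (ω : ℂ) • ρ) := by
              rw [← toEuclideanCLM_limitPot, ← limitBCF_apply ω x]
              simp
            have hfree : (Complex.I * κ) • J ρ + β ρ = ((s + ω : ℝ) : ℂ) • ρ := by
              rw [hρ, packet, map_smul, map_smul, smul_comm (Complex.I * κ), ← smul_add, hwave,
                smul_comm]
            have hsum : J (packetDeriv κ w (4 * ((n : ℝ) + 1) ^ 2) (n + 1) x) + A x ρ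
                - (s : ℂ) • ρ
                = ((deriv cutoff ((x - 4 * ((n : ℝ) + 1) ^ 2) / (n + 1)) / (n + 1) : ℝ) *
                    Complex.exp (Complex.I * κ * x)) • J w + (A - limitBCF ω) x ρ := by
              rw [hAx, packetDeriv, map_add, map_smul, map_smul, ← hρ]
              have h8 : (s : ℂ) • ρ = (Complex.I * κ) • J ρ + β ρ - (ω : ℂ) • ρ := by
                rw [hfree]
                push_cast
                rw [add_smul, add_sub_cancel_right]
              rw [h8]
              module
            rw [hsum]
            refine (norm_add_le _ _).trans ?_
            have t1 : ‖((deriv cutoff ((x - 4 * ((n : ℝ) + 1) ^ 2) / (n + 1)) / (n + 1) : ℝ) *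
                Complex.exp (Complex.I * κ * x)) • J w‖ ≤ ε / 4 * ‖w‖ := by
              rw [norm_smul, norm_mul, norm_exp_I_mul, mul_one, Complex.norm_real, norm_div,
                Real.norm_of_nonneg (hm n).le]
              refine le_trans ?_ hKn
              gcongr
              exact hK _
            have t2 : ‖(A - limitBCF ω) x ρ‖ ≤ ε / 4 * ‖w‖ :=
              (((A - limitBCF ω) x).le_of_opNorm_le (hR x hRx) ρ).trans
                (mul_le_mul_of_nonneg_left (norm_packet_le κ w _ x) (by positivity))
            linarith
          · rw [Set.indicator_of_notMem hxs, packet_eq_zero κ w _ (hm n) hxs,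
              packetDeriv_eq_zero κ w _ (hm n) hxs]
            simp)
      convert this using 3
      ring
    refine hub.trans ?_
    have h4 : √(4 * ((n : ℝ) + 1)) ≤ 2 * √(2 * (n + 1)) := by
      rw [Real.sqrt_le_iff]
      refine ⟨by positivity, ?_⟩
      rw [mul_pow, Real.sq_sqrt (by positivity)]
      linarith [hm n]
    calc (ε / 2 * ‖w‖) * √(4 * (n + 1)) ≤ (ε / 2 * ‖w‖) * (2 * √(2 * (n + 1))) := by gcongr
      _ = ε * (‖w‖ * √(2 * (n + 1))) := by ring
      _ ≤ _ := by gcongr; exact hlow n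

/-- On the two half-lines, the block operator is not Fredholm. -/
theorem not_isFredholm_blockOp {ω : ℝ} {M N : ℝ → Matrix (Fin 2) (Fin 2) ℂ}
    {A B : ℝ →ᵇ (Spin →L[ℂ] Spin)} (hA : IsAsymptoticPot ω M A) (hB : IsAsymptoticPot ω N B)
    {z : ℂ} (hz : z.re = 0 ∧ 1 - ω ≤ |z.im|) :
    ¬ ((blockOp (diracOp M) (diracOp N)).subScalarGraph z).IsFredholm := by
  obtain ⟨P, Q, hPQ, hP0, horth, hW⟩ := exists_weylSequence hz.2
  -- If `ρ` is an approximate eigenvector of both entries with eigenvalue `|Im z|`, then `(ρ, c ρ)`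
  -- with `c = ± i` is one of the block operator with eigenvalue `c |Im z|`.
  obtain ⟨c, hc, hcz⟩ : ∃ c : ℂ, c * c = -1 ∧ z = c * (|z.im| : ℝ) := by
    rcases abs_choice z.im with h | h
    · refine ⟨Complex.I, Complex.I_mul_I, Complex.ext ?_ ?_⟩ <;> simp [h, hz.1]
    · refine ⟨-Complex.I, by simp, Complex.ext ?_ ?_⟩ <;> simp [h, hz.1]
  set s := |z.im| with hs
  have hcn : ‖c‖ = 1 := by
    have := congrArg norm hc
    rw [norm_mul, norm_neg, norm_one] at this
    nlinarith [norm_nonneg c]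
  let kA : ℕ → L2C2 := fun n => JL (Q n) + mulCLM A (P n)
  let kB : ℕ → L2C2 := fun n => JL (Q n) + mulCLM B (P n)
  refine LinearPMap.not_isFredholm_of_orthogonal
    (f := fun n => WithLp.toLp 2 (P n, c • P n)) (l := fun n => WithLp.toLp 2 (c • kA n, -kB n))
    (fun n => ?_) (fun n h => hP0 n ?_) (fun m n hmn => ?_) fun ε hε => ?_
  · refine mem_graph_blockOp.mpr ⟨?_, ?_⟩
    · exact Submodule.smul_mem _ c ((mem_graph_diracOp hA.apply_eq).mpr ⟨Q n, hPQ n, rfl⟩)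
    · simp only [WithLp.toLp_snd, neg_neg, WithLp.toLp_fst]
      exact (mem_graph_diracOp hB.apply_eq).mpr ⟨Q n, hPQ n, rfl⟩
  · exact congrArg (fun f : L2C4 => f.fst) h
  · simp [WithLp.prod_inner_apply, inner_smul_left, inner_smul_right, horth m n hmn]
  · filter_upwards [hW A hA.decay (ε / 2) (by positivity), hW B hB.decay (ε / 2) (by positivity)]
      with n h1 h2
    have e : (WithLp.toLp 2 (c • kA n, -kB n) : L2C4) - z • WithLp.toLp 2 (P n, c • P n)
        = WithLp.toLp 2 (c • (kA n - (s : ℂ) • P n), -(kB n - (s : ℂ) • P n)) := by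
      refine WithLp.ofLp_injective 2 (Prod.ext ?_ ?_)
      · change c • kA n - z • P n = _
        rw [hcz, mul_smul, ← smul_sub]
      · change -kB n - z • c • P n = _
        rw [smul_smul, hcz, mul_right_comm, hc, neg_one_mul, neg_smul]
        module
    rw [e]
    have hn1 : ‖P n‖ ≤ ‖(WithLp.toLp 2 (P n, c • P n) : L2C4)‖ := by
      refine le_of_sq_le_sq ?_ (norm_nonneg _)
      rw [WithLp.prod_norm_sq_eq_of_L2]
      simp only [WithLp.toLp_fst, WithLp.toLp_snd]
      nlinarith [sq_nonneg ‖c • P n‖]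
    have hn2 : ∀ a b : L2C2, ‖(WithLp.toLp 2 (a, b) : L2C4)‖ ≤ ‖a‖ + ‖b‖ := fun a b => by
      refine le_of_sq_le_sq ?_ (by positivity)
      rw [WithLp.prod_norm_sq_eq_of_L2]
      simp only [WithLp.toLp_fst, WithLp.toLp_snd]
      nlinarith [norm_nonneg a, norm_nonneg b]
    refine (hn2 _ _).trans ?_
    rw [norm_smul, hcn, one_mul, norm_neg]
    calc ‖kA n - (s : ℂ) • P n‖ + ‖kB n - (s : ℂ) • P n‖
        ≤ ε / 2 * ‖P n‖ + ε / 2 * ‖P n‖ := add_le_add h1 h2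
      _ = ε * ‖P n‖ := by ring
      _ ≤ _ := by gcongr

end NLDirac

namespace NLDirac
open Filter Topology ComplexConjugate
open scoped BoundedContinuousFunction

/-! ### The null space of a one-dimensional Dirac operator -/

/-- The null space of a one-dimensional Dirac operator with symmetric potential is spanned by any
of its nonzero classical solutions: the Wronskian of two solutions is constant and integrable,
hence zero. -/
theorem eq_smul_of_mem_graph_zero {M : ℝ → Matrix (Fin 2) (Fin 2) ℂ}
    {A : ℝ →ᵇ (Spin →L[ℂ] Spin)} (hA : ∀ x, A x = Matrix.toEuclideanCLM (𝕜 := ℂ) (M x))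
    (hM : ∀ x, M x 0 1 = M x 1 0) {φ : ℝ → Spin} (hφ : ∀ x, HasDerivAt φ (J (A x (φ x))) x)
    (hφ2 : MemLp φ 2 volume) (hφ0 : ∃ x, φ x ≠ 0) {f : L2C2}
    (hf : (f, 0) ∈ (diracOp M).graph) : ∃ c : ℂ, f = c • hφ2.toLp φ := by
  obtain ⟨h, hfh, h0⟩ := (mem_graph_diracOp hA).mp hf
  have hh : h = JL (mulCLM A f) := by
    have := congrArg JL (eq_neg_of_add_eq_zero_left h0.symm)
    rw [JL_JL, map_neg, neg_inj] at this
    exact this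
  -- The continuous representative of `f` is a classical solution.
  obtain ⟨F, hFc, hfF, hF⟩ := hfh.exists_continuous_rep
  have hFc' : Continuous fun t => J (A t (F t)) :=
    J.continuous.comp (A.continuous.clm_apply hFc)
  have hFd : ∀ x, HasDerivAt F (J (A x (F x))) x := fun x => by
    have e : F = fun y => F 0 + ∫ t in (0 : ℝ)..y, J (A t (F t)) := by
      funext y
      rw [← sub_eq_iff_eq_add', hF]
      refine intervalIntegral.integral_congr_ae ?_
      filter_upwards [J.coeFn_compLpL (p := 2) (mulCLM A f), coeFn_mulCLM A f, hfF]
        with t h1 h2 h3 _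
      rw [hh]
      change (J.compLpL 2 volume) (mulCLM A f) t = _
      rw [h1, h2, h3]
    have h1 := (hFc'.integral_hasStrictDerivAt 0 x).hasDerivAt.const_add (F 0)
    rw [← e] at h1
    exact h1
  have hFL : MemLp F 2 volume := (memLp_congr_ae hfF).mp (Lp.memLp f)
  -- The Wronskian of the two solutions.
  let W : ℝ → ℂ := fun x => F x 0 * φ x 1 - F x 1 * φ x 0
  have hWd : ∀ x, HasDerivAt W 0 x := fun x => by
    have hp : ∀ (i : Fin 2) {G : ℝ → Spin} {G' : Spin}, HasDerivAt G G' x →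
        HasDerivAt (fun x => G x i) (G' i) x := fun i G G' hG =>
      ((EuclideanSpace.proj (𝕜 := ℂ) i).restrictScalars ℝ).hasFDerivAt.comp_hasDerivAt x hG
    refine HasDerivAt.congr_deriv
      (((hp 0 (hFd x)).mul (hp 1 (hφ x))).sub ((hp 1 (hFd x)).mul (hp 0 (hφ x)))) ?_
    simp only [hA, J_apply]
    simp [Matrix.ofLp_toEuclideanCLM, Matrix.mulVec, dotProduct, Fin.sum_univ_two, hM]
    ring
  have hWc : ∀ x y, W x = W y := is_const_of_deriv_eq_zero
    (fun x => (hWd x).differentiableAt) fun x => (hWd x).deriv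
  have hWi : Integrable W := by
    have hp : ∀ (i : Fin 2) {G : ℝ → Spin}, MemLp G 2 volume → MemLp (fun x => G x i) 2 volume :=
      fun i G hG => (EuclideanSpace.proj (𝕜 := ℂ) i).comp_memLp' hG
    exact ((hp 0 hFL).integrable_mul (hp 1 hφ2)).sub ((hp 1 hFL).integrable_mul (hp 0 hφ2))
  have hW0 : ∀ x, W x = 0 := fun x => by
    have : W = fun _ => W x := funext fun y => hWc y x
    rw [this, integrable_const_iff] at hWi
    refine hWi.resolve_right fun h => ?_
    simpa using h.measure_univ_lt_top
  obtain ⟨x₀, hx₀⟩ := hφ0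
  -- Proportionality at one point propagates by uniqueness for the initial value problem.
  obtain ⟨c, hc⟩ : ∃ c : ℂ, F x₀ = c • φ x₀ := by
    have hW := hW0 x₀
    simp only [W] at hW
    by_cases h : φ x₀ 0 = 0
    · have h1 : φ x₀ 1 ≠ 0 := fun h1 => hx₀ (by ext i; fin_cases i <;> simp [h, h1])
      refine ⟨F x₀ 1 / φ x₀ 1, ?_⟩
      ext i
      fin_cases i
      · simp only [Fin.zero_eta, PiLp.smul_apply, smul_eq_mul]
        field_simp
        linear_combination hW
      · simp [h1]
    · refine ⟨F x₀ 0 / φ x₀ 0, ?_⟩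
      ext i
      fin_cases i
      · simp [h]
      · simp only [Fin.mk_one, PiLp.smul_apply, smul_eq_mul]
        field_simp
        linear_combination -hW
  have hunique : F = fun x => c • φ x := by
    refine ODE_solution_unique_univ (v := fun t a => J (A t a)) (s := fun _ => Set.univ)
      (K := ‖J‖₊ * ‖A‖₊) (t₀ := x₀) (fun t => LipschitzWith.lipschitzOnWith ?_)
      (fun t => ⟨hFd t, trivial⟩) (fun t => ⟨?_, trivial⟩) hc
    · refine LipschitzWith.of_dist_le_mul fun a b => ?_
      rw [dist_eq_norm, dist_eq_norm, ← map_sub, ← map_sub]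
      push_cast
      rw [mul_assoc]
      exact J.le_opNorm_of_le ((A t).le_of_opNorm_le (A.norm_coe_le_norm t) _)
    · rw [map_smul, map_smul]
      exact (hφ t).const_smul c
  refine ⟨c, Lp.ext ?_⟩
  filter_upwards [hfF, Lp.coeFn_smul c (hφ2.toLp φ), hφ2.coeFn_toLp] with x h1 h2 h3
  rw [h1, h2, Pi.smul_apply, h3, hunique]

/-- Square integrable classical solutions of `J φ' + A φ = k` belong to the graph of the Dirac
operator. -/
theorem mem_graph_diracOp_of_hasDerivAt {M : ℝ → Matrix (Fin 2) (Fin 2) ℂ}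
    {A : ℝ →ᵇ (Spin →L[ℂ] Spin)} (hA : ∀ x, A x = Matrix.toEuclideanCLM (𝕜 := ℂ) (M x))
    {φ φ' k : ℝ → Spin} (hφ : MemLp φ 2 volume) (hφ' : MemLp φ' 2 volume) (hk : MemLp k 2 volume)
    (hd : ∀ x, HasDerivAt φ (φ' x) x) (he : ∀ x, J (φ' x) + A x (φ x) = k x) :
    (hφ.toLp φ, hk.toLp k) ∈ (diracOp M).graph := by
  refine (mem_graph_diracOp hA).mpr ⟨_, isWeakDeriv_of_hasDerivAt hφ hφ' hd, Lp.ext ?_⟩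
  filter_upwards [hφ.coeFn_toLp, hφ'.coeFn_toLp, hk.coeFn_toLp, coeFn_mulCLM A (hφ.toLp φ),
    J.coeFn_compLpL (p := 2) (hφ'.toLp φ'),
    Lp.coeFn_add (JL (hφ'.toLp φ')) (mulCLM A (hφ.toLp φ))] with x h1 h2 h3 h4 h5 h6
  rw [h6, Pi.add_apply, h3, h4, h1, ← he]
  change _ = (J.compLpL 2 volume) (hφ'.toLp φ') x + _
  rw [h5, h2]

end NLDirac

namespace NLDirac
open Filter Topology ComplexConjugate
open scoped BoundedContinuousFunction ZeroAtInfty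

/-! ### Solitary waves -/

/-- Functions in `H¹(ℝ)` vanish at infinity: `f²` and its derivative are integrable. -/
theorem tendsto_cocompact_zero {f : ℝ → ℝ} (hd : Differentiable ℝ f) (hf : MemLp f 2 volume)
    (hf' : MemLp (deriv f) 2 volume) : Tendsto f (cocompact ℝ) (𝓝 0) := by
  have hd2 : ∀ x, HasDerivAt (fun x => f x * f x) (deriv f x * f x + f x * deriv f x) x :=
    fun x => (hd x).hasDerivAt.mul (hd x).hasDerivAt
  have hi : Integrable fun x => f x * f x := hf.integrable_mul hf
  have hi' : Integrable fun x => deriv f x * f x + f x * deriv f x :=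
    (hf'.integrable_mul hf).add (hf.integrable_mul hf')
  have h : Tendsto (fun x => f x * f x) (cocompact ℝ) (𝓝 0) := by
    rw [cocompact_eq_atBot_atTop]
    exact Tendsto.sup
      (tendsto_zero_of_hasDerivAt_of_integrableOn_Iic (a := 0) (fun x _ => hd2 x)
        hi'.integrableOn hi.integrableOn)
      (tendsto_zero_of_hasDerivAt_of_integrableOn_Ioi (a := 0) (fun x _ => hd2 x)
        hi'.integrableOn hi.integrableOn)
  have h2 := h.sqrt
  simp only [Real.sqrt_mul_self_eq_abs, Real.sqrt_zero] at h2
  exact (tendsto_zero_iff_abs_tendsto_zero f).mpr h2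

/-- A potential which is a continuous function of `(v, u)`, where `v` and `u` vanish at infinity,
satisfies the assumptions of the spectral analysis. -/
theorem exists_isAsymptoticPot {ω : ℝ} {Φ : ℝ × ℝ → Matrix (Fin 2) (Fin 2) ℂ} (hΦ : Continuous Φ)
    (hΦ0 : Φ 0 = limitPot ω) (hΦs : ∀ p, (Φ p).IsHermitian) {v u : ℝ → ℝ}
    (hv : Continuous v) (hu : Continuous u) (hv0 : Tendsto v (cocompact ℝ) (𝓝 0))
    (hu0 : Tendsto u (cocompact ℝ) (𝓝 0)) : ∃ A, IsAsymptoticPot ω (fun x => Φ (v x, u x)) A := by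
  have hT : Continuous (Matrix.toEuclideanCLM (𝕜 := ℂ) (n := Fin 2)) :=
    LinearMap.continuous_of_finiteDimensional
      (Matrix.toEuclideanCLM (𝕜 := ℂ) (n := Fin 2)).toAlgEquiv.toLinearMap
  let D : C₀(ℝ, Spin →L[ℂ] Spin) :=
    { toFun := fun x => Matrix.toEuclideanCLM (𝕜 := ℂ) (Φ (v x, u x))
        - Matrix.toEuclideanCLM (𝕜 := ℂ) (limitPot ω)
      continuous_toFun := (hT.comp (hΦ.comp (hv.prodMk hu))).sub continuous_const
      zero_at_infty' := by
        have h1 : Tendsto (fun x => Matrix.toEuclideanCLM (𝕜 := ℂ) (Φ (v x, u x))) (cocompact ℝ)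
            (𝓝 (Matrix.toEuclideanCLM (𝕜 := ℂ) (Φ 0))) :=
          ((hT.comp hΦ).tendsto 0).comp (hv0.prodMk_nhds hu0)
        rw [hΦ0] at h1
        simpa using h1.sub_const (Matrix.toEuclideanCLM (𝕜 := ℂ) (limitPot ω)) }
  have hA : ∀ x, (D.toBCF + limitBCF ω) x = Matrix.toEuclideanCLM (𝕜 := ℂ) (Φ (v x, u x)) :=
    fun x => sub_add_cancel _ _
  refine ⟨D.toBCF + limitBCF ω, hA, fun x a b => ?_, fun ε hε => ?_⟩
  · rw [hA, ← ContinuousLinearMap.adjoint_inner_right, ← ContinuousLinearMap.star_eq_adjoint,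
      ← map_star, Matrix.star_eq_conjTranspose, hΦs]
  · have h1 := (tendsto_zero_iff_norm_tendsto_zero.mp D.zero_at_infty').eventually_le_const hε
    rw [← Metric.cobounded_eq_cocompact, ← comap_norm_atTop] at h1
    obtain ⟨t, ht, hts⟩ := mem_comap.mp h1
    obtain ⟨R, hR⟩ := mem_atTop_sets.mp ht
    refine ⟨R, fun x hx => ?_⟩
    have h2 : (D.toBCF + limitBCF ω - limitBCF ω) x = D x := add_sub_cancel_right (D x) _
    rw [h2]
    exact hts (hR |x| hx)

theorem continuous_potMinus {g : ℝ → ℝ} (hg : Continuous g) (ω : ℝ) :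
    Continuous fun p : ℝ × ℝ => potMinus g ω (fun _ => p.1) (fun _ => p.2) 0 := by
  refine continuous_pi fun i => continuous_pi fun j => ?_
  fin_cases i <;> fin_cases j <;> simp [potMinus] <;> fun_prop

theorem continuous_potPlus {g : ℝ → ℝ} (hg : Continuous g) (hg' : Continuous (deriv g)) (ω : ℝ) :
    Continuous fun p : ℝ × ℝ => potPlus g ω (fun _ => p.1) (fun _ => p.2) 0 := by
  refine continuous_pi fun i => continuous_pi fun j => ?_
  fin_cases i <;> fin_cases j <;> simp [potPlus] <;> fun_prop

/-- The spinor-valued function underlying `spinor`. -/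
noncomputable def spinorFun (a b : ℝ → ℝ) (x : ℝ) : Spin := !₂[(a x : ℂ), (b x : ℂ)]

theorem hasDerivAt_spinorFun {a b : ℝ → ℝ} {a' b' x : ℝ} (ha : HasDerivAt a a' x)
    (hb : HasDerivAt b b' x) :
    HasDerivAt (spinorFun a b) !₂[(a' : ℂ), (b' : ℂ)] x := by
  have h : HasDerivAt (fun x => ![(a x : ℂ), (b x : ℂ)]) ![(a' : ℂ), (b' : ℂ)] x := by
    refine hasDerivAt_pi.mpr fun i => ?_
    fin_cases i
    · exact ha.ofReal_comp
    · exact hb.ofReal_comp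
  exact (((EuclideanSpace.equiv (Fin 2) ℂ).symm :
    (Fin 2 → ℂ) →L[ℂ] Spin).restrictScalars ℝ).hasFDerivAt.comp_hasDerivAt x h

/-- A linear combination with real matrix coefficients, written out in components. -/
theorem toEuclideanCLM_map_ofReal_spinorFun (p q r s : ℝ) (a b : ℝ → ℝ) (x : ℝ) :
    Matrix.toEuclideanCLM (𝕜 := ℂ) ((!![p, q; r, s] : Matrix (Fin 2) (Fin 2) ℝ).map Complex.ofReal)
      (spinorFun a b x) = !₂[((p * a x + q * b x : ℝ) : ℂ), ((r * a x + s * b x : ℝ) : ℂ)] := by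
  ext i
  fin_cases i <;> simp [spinorFun]

namespace IsSolitaryWave

variable {g : ℝ → ℝ} {ω : ℝ} {v u : ℝ → ℝ}

theorem deriv_v (hφ : IsSolitaryWave g ω v u) (x : ℝ) :
    deriv v x = -((ω + g (v x ^ 2 - u x ^ 2)) * u x) := by
  linarith [hφ.eq_u x]

theorem deriv_u (hφ : IsSolitaryWave g ω v u) (x : ℝ) :
    deriv u x = (ω - g (v x ^ 2 - u x ^ 2)) * v x := by
  linarith [hφ.eq_v x]

theorem hasDerivAt_g (hφ : IsSolitaryWave g ω v u) (hg : Differentiable ℝ g) (x : ℝ) :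
    HasDerivAt (fun x => g (v x ^ 2 - u x ^ 2))
      (deriv g (v x ^ 2 - u x ^ 2) * (2 * v x * deriv v x - 2 * u x * deriv u x)) x := by
  have h := (((hφ.differentiable_v x).hasDerivAt.pow 2).sub
    ((hφ.differentiable_u x).hasDerivAt.pow 2))
  have h2 := (hg (v x ^ 2 - u x ^ 2)).hasDerivAt.comp x h
  refine h2.congr_deriv ?_
  simp

theorem hasDerivAt_deriv_v (hφ : IsSolitaryWave g ω v u) (hg : Differentiable ℝ g) (x : ℝ) :
    HasDerivAt (deriv v)
      (-(deriv g (v x ^ 2 - u x ^ 2) * (2 * v x * deriv v x - 2 * u x * deriv u x) * u x +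
        (ω + g (v x ^ 2 - u x ^ 2)) * deriv u x)) x := by
  exact (((hφ.hasDerivAt_g hg x).const_add ω).mul
    (hφ.differentiable_u x).hasDerivAt).neg.congr_of_eventuallyEq (.of_forall hφ.deriv_v)

theorem hasDerivAt_deriv_u (hφ : IsSolitaryWave g ω v u) (hg : Differentiable ℝ g) (x : ℝ) :
    HasDerivAt (deriv u)
      (-(deriv g (v x ^ 2 - u x ^ 2) * (2 * v x * deriv v x - 2 * u x * deriv u x)) * v x +
        (ω - g (v x ^ 2 - u x ^ 2)) * deriv v x) x := by
  exact (((hφ.hasDerivAt_g hg x).const_sub ω).mul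
    (hφ.differentiable_v x).hasDerivAt).congr_of_eventuallyEq (.of_forall hφ.deriv_u)

theorem tendsto_v (hφ : IsSolitaryWave g ω v u) : Tendsto v (cocompact ℝ) (𝓝 0) :=
  tendsto_cocompact_zero hφ.differentiable_v hφ.memLp_v hφ.memLp_deriv_v

theorem tendsto_u (hφ : IsSolitaryWave g ω v u) : Tendsto u (cocompact ℝ) (𝓝 0) :=
  tendsto_cocompact_zero hφ.differentiable_u hφ.memLp_u hφ.memLp_deriv_u

theorem exists_isAsymptoticPot_potMinus (hφ : IsSolitaryWave g ω v u) (hg : Continuous g)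
    (hg0 : g 0 = 1) : ∃ A, IsAsymptoticPot ω (potMinus g ω v u) A := by
  refine exists_isAsymptoticPot (Φ := fun p => potMinus g ω (fun _ => p.1) (fun _ => p.2) 0)
    (continuous_potMinus hg ω) ?_ (fun p => ?_) hφ.differentiable_v.continuous
    hφ.differentiable_u.continuous hφ.tendsto_v hφ.tendsto_u
  · ext i j
    fin_cases i <;> fin_cases j <;> simp [potMinus, limitPot, hg0]
  · ext i j
    fin_cases i <;> fin_cases j <;> simp [potMinus]

theorem exists_isAsymptoticPot_potPlus (hφ : IsSolitaryWave g ω v u) (hg : Continuous g)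
    (hg' : Continuous (deriv g)) (hg0 : g 0 = 1) :
    ∃ A, IsAsymptoticPot ω (potPlus g ω v u) A := by
  refine exists_isAsymptoticPot (Φ := fun p => potPlus g ω (fun _ => p.1) (fun _ => p.2) 0)
    (continuous_potPlus hg hg' ω) ?_ (fun p => ?_) hφ.differentiable_v.continuous
    hφ.differentiable_u.continuous hφ.tendsto_v hφ.tendsto_u
  · ext i j
    fin_cases i <;> fin_cases j <;> simp [potPlus, limitPot, hg0]
  · ext i j
    fin_cases i <;> fin_cases j <;> simp [potPlus]

theorem exists_spinorFun_ne_zero (hφ : IsSolitaryWave g ω v u) : ∃ x, spinorFun v u x ≠ 0 := by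
  obtain ⟨x, hx⟩ := hφ.ne_zero
  refine ⟨x, fun h => ?_⟩
  have h0 := congrArg (fun a : Spin => a 0) h
  have h1 := congrArg (fun a : Spin => a 1) h
  simp [spinorFun] at h0 h1
  tauto

/-- The derivative of a solitary wave does not vanish identically, since a constant function which
tends to zero at infinity is zero. -/
theorem exists_spinorFun_deriv_ne_zero (hφ : IsSolitaryWave g ω v u) :
    ∃ x, spinorFun (deriv v) (deriv u) x ≠ 0 := by
  by_contra! h
  have key : ∀ {f : ℝ → ℝ}, Differentiable ℝ f → Tendsto f (cocompact ℝ) (𝓝 0) →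
      (∀ x, deriv f x = 0) → ∀ x, f x = 0 := fun {f} hd ht h0 x => by
    have hc : f = fun _ => f x := funext fun y => is_const_of_deriv_eq_zero hd h0 y x
    rw [hc] at ht
    exact tendsto_nhds_unique tendsto_const_nhds ht
  have hv : ∀ x, deriv v x = 0 := fun x => by
    simpa [spinorFun] using congrArg (fun a : Spin => a 0) (h x)
  have hu : ∀ x, deriv u x = 0 := fun x => by
    simpa [spinorFun] using congrArg (fun a : Spin => a 1) (h x)
  obtain ⟨x, hx⟩ := hφ.ne_zero
  have h1 := key hφ.differentiable_v hφ.tendsto_v hv x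
  have h2 := key hφ.differentiable_u hφ.tendsto_u hu x
  tauto

theorem spinor_swap_ne_zero (hφ : IsSolitaryWave g ω v u) :
    spinor hφ.memLp_u hφ.memLp_v ≠ 0 := fun h => by
  have h1 : spinorFun u v =ᵐ[volume] 0 :=
    (memLp_spinor hφ.memLp_u hφ.memLp_v).coeFn_toLp.symm.trans
      ((Lp.ext_iff.mp h).trans (Lp.coeFn_zero _ _ _))
  have hc : Continuous (spinorFun u v) := continuous_iff_continuousAt.mpr fun x =>
    (NLDirac.hasDerivAt_spinorFun (hφ.differentiable_u x).hasDerivAt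
      (hφ.differentiable_v x).hasDerivAt).continuousAt
  have h2 := (hc.ae_eq_iff_eq volume continuous_zero).mp h1
  obtain ⟨x, hx⟩ := hφ.ne_zero
  have h3 := congrArg (fun a : Spin => a 0) (congrFun h2 x)
  have h4 := congrArg (fun a : Spin => a 1) (congrFun h2 x)
  simp [spinorFun] at h3 h4
  tauto

/-- The equation of a solitary wave `φ`, which reads `ℋ₋ φ = 0`, in the form `φ' = J A φ`. -/
theorem hasDerivAt_spinorFun (hφ : IsSolitaryWave g ω v u) (x : ℝ) :
    HasDerivAt (spinorFun v u)
      (J (Matrix.toEuclideanCLM (𝕜 := ℂ) (potMinus g ω v u x) (spinorFun v u x))) x := by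
  refine (NLDirac.hasDerivAt_spinorFun (hφ.differentiable_v x).hasDerivAt
    (hφ.differentiable_u x).hasDerivAt).congr_deriv ?_
  rw [potMinus, toEuclideanCLM_map_ofReal_spinorFun, J_apply, hφ.deriv_v, hφ.deriv_u]
  ext i
  fin_cases i <;> simp <;> ring

/-- Differentiating the equation of a solitary wave `φ` gives `ℋ₊ φ' = 0`. -/
theorem hasDerivAt_spinorFun_deriv (hφ : IsSolitaryWave g ω v u) (hg : Differentiable ℝ g) (x : ℝ) :
    HasDerivAt (spinorFun (deriv v) (deriv u))
      (J (Matrix.toEuclideanCLM (𝕜 := ℂ) (potPlus g ω v u x)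
        (spinorFun (deriv v) (deriv u) x))) x := by
  refine (NLDirac.hasDerivAt_spinorFun (hφ.hasDerivAt_deriv_v hg x)
    (hφ.hasDerivAt_deriv_u hg x)).congr_deriv ?_
  rw [potPlus, toEuclideanCLM_map_ofReal_spinorFun, J_apply]
  ext i
  fin_cases i <;> simp <;> ring

/-- `ℋ₋ (u, v) = -2ω (u, v)`. -/
theorem dirac_minus_swap (hφ : IsSolitaryWave g ω v u) (x : ℝ) :
    J (spinorFun (deriv u) (deriv v) x) +
      Matrix.toEuclideanCLM (𝕜 := ℂ) (potMinus g ω v u x) (spinorFun u v x) =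
      (-(2 * ω) : ℂ) • spinorFun u v x := by
  rw [potMinus, toEuclideanCLM_map_ofReal_spinorFun, J_apply, spinorFun, spinorFun, hφ.deriv_v,
    hφ.deriv_u]
  ext i
  fin_cases i <;> simp <;> ring

/-- `ℋ₊ (u, v) = -2ω (u, v)`: the terms with `g'` in `ℋ₊` annihilate `(u, v)`. -/
theorem dirac_plus_swap (hφ : IsSolitaryWave g ω v u) (x : ℝ) :
    J (spinorFun (deriv u) (deriv v) x) +
      Matrix.toEuclideanCLM (𝕜 := ℂ) (potPlus g ω v u x) (spinorFun u v x) =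
      (-(2 * ω) : ℂ) • spinorFun u v x := by
  rw [potPlus, toEuclideanCLM_map_ofReal_spinorFun, J_apply, spinorFun, spinorFun, hφ.deriv_v,
    hφ.deriv_u]
  ext i
  fin_cases i <;> simp <;> ring

end IsSolitaryWave
end NLDirac

namespace NLDirac
open scoped BoundedContinuousFunction

/-! ### The spectrum of the linearization -/

theorem essentialSpectrum_blockOp {ω : ℝ} (hω0 : 0 < ω) (hω1 : ω < 1)
    {M N : ℝ → Matrix (Fin 2) (Fin 2) ℂ} {A B : ℝ →ᵇ (Spin →L[ℂ] Spin)}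
    (hA : IsAsymptoticPot ω M A) (hB : IsAsymptoticPot ω N B) :
    (blockOp (diracOp M) (diracOp N)).essentialSpectrum =
      {z : ℂ | z.re = 0 ∧ 1 - ω ≤ |z.im|} := by
  ext z
  exact ⟨fun h => not_not.mp fun hz => h (isFredholm_blockOp hω0 hω1 hA hB hz),
    fun hz => not_isFredholm_blockOp hA hB hz⟩

theorem nullSpace_blockOp {A B : L2C2 →ₗ.[ℂ] L2C2} {p q : L2C2}
    (hp : (p, 0) ∈ A.graph) (hA : ∀ f, (f, 0) ∈ A.graph → ∃ c : ℂ, f = c • p)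
    (hq : (q, 0) ∈ B.graph) (hB : ∀ f, (f, 0) ∈ B.graph → ∃ c : ℂ, f = c • q) :
    (blockOp A B).nullSpace = Submodule.span ℂ
      {(WithLp.toLp 2 (q, 0) : L2C4), (WithLp.toLp 2 (0, p) : L2C4)} := by
  refine le_antisymm (fun f hf => ?_) (Submodule.span_le.mpr ?_)
  · obtain ⟨h1, h2⟩ := mem_graph_blockOp.mp (LinearPMap.mem_nullSpace_iff.mp hf)
    obtain ⟨c, hc⟩ := hA _ h1
    obtain ⟨d, hd⟩ := hB _ (by simpa using h2)
    refine Submodule.mem_span_pair.mpr ⟨d, c, WithLp.ofLp_injective 2 (Prod.ext ?_ ?_)⟩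
    · exact (congrArg₂ _ rfl (smul_zero c)).trans ((add_zero _).trans hd.symm)
    · exact (congrArg₂ _ (smul_zero d) rfl).trans ((zero_add _).trans hc.symm)
  · rintro f (rfl | rfl)
    · refine LinearPMap.mem_nullSpace_iff.mpr (mem_graph_blockOp.mpr ⟨?_, ?_⟩)
      · exact A.graph.zero_mem
      · simpa using hq
    · refine LinearPMap.mem_nullSpace_iff.mpr (mem_graph_blockOp.mpr ⟨hp, ?_⟩)
      simp

/-- A square integrable classical solution of `F' = J A F` is in the null space of the Dirac
operator with potential `A`. -/
theorem mem_graph_zero_of_hasDerivAt {M : ℝ → Matrix (Fin 2) (Fin 2) ℂ}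
    {A : ℝ →ᵇ (Spin →L[ℂ] Spin)} {F : ℝ → Spin} (hF : MemLp F 2 volume)
    (hA : ∀ x, A x = Matrix.toEuclideanCLM (𝕜 := ℂ) (M x))
    (hd : ∀ x, HasDerivAt F (J (A x (F x))) x) : (hF.toLp F, 0) ∈ (diracOp M).graph := by
  have := mem_graph_diracOp_of_hasDerivAt hA hF (J.comp_memLp' (memLp_bcf_apply A hF))
    MemLp.zero hd fun x => (congrArg (· + A x (F x)) (J_J _)).trans (neg_add_cancel _)
  simpa using this

/-- A common eigenvector `p` of `A` and `B` with eigenvalue `t` gives the eigenvectors `(p, c p)`,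
`c = ± i`, of the block operator. -/
theorem isEigenvector_blockOp {A B : L2C2 →ₗ.[ℂ] L2C2} {p : L2C2} {t c : ℂ} (hp0 : p ≠ 0)
    (hA : (p, t • p) ∈ A.graph) (hB : (p, t • p) ∈ B.graph) (hc : c * c = -1) :
    (blockOp A B).IsEigenvector (t * c) (WithLp.toLp 2 (p, c • p)) := by
  refine LinearPMap.isEigenvector_iff_mem_graph.mpr
    ⟨fun h => hp0 (congrArg (fun f : L2C4 => f.fst) h), mem_graph_blockOp.mpr ⟨?_, ?_⟩⟩
  · have := A.graph.smul_mem c hA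
    simpa [smul_smul, mul_comm] using this
  · have e : -((t * c) • c • p) = t • p := by
      rw [smul_smul, mul_assoc, hc, mul_neg_one, neg_smul, neg_neg]
    simpa [e] using hB

namespace IsSolitaryWave

variable {g : ℝ → ℝ} {ω : ℝ} {v u : ℝ → ℝ}

theorem nullSpace_linOp (hφ : IsSolitaryWave g ω v u) (hg : Differentiable ℝ g)
    {A B : ℝ →ᵇ (Spin →L[ℂ] Spin)} (hA : IsAsymptoticPot ω (potMinus g ω v u) A)
    (hB : IsAsymptoticPot ω (potPlus g ω v u) B) :
    (linOp g ω v u).nullSpace = Submodule.span ℂ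
      {(WithLp.toLp 2 (spinor hφ.memLp_deriv_v hφ.memLp_deriv_u, 0) : L2C4),
        (WithLp.toLp 2 (0, spinor hφ.memLp_v hφ.memLp_u) : L2C4)} := by
  have hφ2 : MemLp (spinorFun v u) 2 volume := memLp_spinor hφ.memLp_v hφ.memLp_u
  have hψ2 : MemLp (spinorFun (deriv v) (deriv u)) 2 volume :=
    memLp_spinor hφ.memLp_deriv_v hφ.memLp_deriv_u
  have hφd : ∀ x, HasDerivAt (spinorFun v u) (J (A x (spinorFun v u x))) x := fun x => by
    rw [hA.apply_eq]
    exact hφ.hasDerivAt_spinorFun x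
  have hψd : ∀ x, HasDerivAt (spinorFun (deriv v) (deriv u))
      (J (B x (spinorFun (deriv v) (deriv u) x))) x := fun x => by
    rw [hB.apply_eq]
    exact hφ.hasDerivAt_spinorFun_deriv hg x
  exact nullSpace_blockOp (mem_graph_zero_of_hasDerivAt hφ2 hA.apply_eq hφd)
    (fun f hf => eq_smul_of_mem_graph_zero hA.apply_eq (fun x => by simp [potMinus]) hφd hφ2
      hφ.exists_spinorFun_ne_zero hf)
    (mem_graph_zero_of_hasDerivAt hψ2 hB.apply_eq hψd)
    (fun f hf => eq_smul_of_mem_graph_zero hB.apply_eq (fun x => by simp [potPlus]) hψd hψ2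
      hφ.exists_spinorFun_deriv_ne_zero hf)

/-- The vectors `(ϕ, c ϕ)` with `ϕ = (u, v)` and `c = ± i` are eigenvectors of the linearization,
since `ϕ` is an eigenvector of both `ℋ₋` and `ℋ₊` with eigenvalue `-2ω`. -/
theorem isEigenvector_linOp (hφ : IsSolitaryWave g ω v u) {A B : ℝ →ᵇ (Spin →L[ℂ] Spin)}
    (hA : IsAsymptoticPot ω (potMinus g ω v u) A) (hB : IsAsymptoticPot ω (potPlus g ω v u) B)
    {c : ℂ} (hc : c * c = -1) :
    (linOp g ω v u).IsEigenvector (-(2 * ω) * c)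
      (WithLp.toLp 2 (spinor hφ.memLp_u hφ.memLp_v, c • spinor hφ.memLp_u hφ.memLp_v)) := by
  have hχ : MemLp (spinorFun u v) 2 volume := memLp_spinor hφ.memLp_u hφ.memLp_v
  have hχ' : MemLp (spinorFun (deriv u) (deriv v)) 2 volume :=
    memLp_spinor hφ.memLp_deriv_u hφ.memLp_deriv_v
  have hd : ∀ x, HasDerivAt (spinorFun u v) (spinorFun (deriv u) (deriv v) x) x := fun x =>
    NLDirac.hasDerivAt_spinorFun (hφ.differentiable_u x).hasDerivAt
      (hφ.differentiable_v x).hasDerivAt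
  refine isEigenvector_blockOp hφ.spinor_swap_ne_zero ?_ ?_ hc
  · exact mem_graph_diracOp_of_hasDerivAt hA.apply_eq hχ hχ' (hχ.const_smul (-(2 * ω) : ℂ)) hd
      fun x => by rw [hA.apply_eq]; exact hφ.dirac_minus_swap x
  · exact mem_graph_diracOp_of_hasDerivAt hB.apply_eq hχ hχ' (hχ.const_smul (-(2 * ω) : ℂ)) hd
      fun x => by rw [hB.apply_eq]; exact hφ.dirac_plus_swap x

end IsSolitaryWave

end NLDirac

theorem mainTheorem2 (g : ℝ → ℝ) (hg : ContDiff ℝ (⊤ : ℕ∞) g) (hg0 : g 0 = 1)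
    (ω : ℝ) (hω0 : 0 < ω) (hω1 : ω < 1) (v u : ℝ → ℝ)
    (hφ : NLDirac.IsSolitaryWave g ω v u) :
    -- the continuous spectrum (embedded eigenvalues included, respectively removed)
    ((NLDirac.linOp g ω v u).essentialSpectrum = {z : ℂ | z.re = 0 ∧ 1 - ω ≤ |z.im|} ∧
      (NLDirac.linOp g ω v u).continuousSpectrum =
        {z : ℂ | z.re = 0 ∧ 1 - ω ≤ |z.im|} \ (NLDirac.linOp g ω v u).pointSpectrum) ∧
    -- the kernel
    (NLDirac.linOp g ω v u).nullSpace = Submodule.span ℂ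
      {(WithLp.toLp 2 (NLDirac.spinor hφ.memLp_deriv_v hφ.memLp_deriv_u, 0) : NLDirac.L2C4),
        (WithLp.toLp 2 (0, NLDirac.spinor hφ.memLp_v hφ.memLp_u) : NLDirac.L2C4)} ∧
    -- the eigenvalues `±2iω`, with their eigenvectors
    ((NLDirac.linOp g ω v u).IsEigenvector (-(2 * Complex.I * ω))
        (WithLp.toLp 2 (NLDirac.spinor hφ.memLp_u hφ.memLp_v,
          Complex.I • NLDirac.spinor hφ.memLp_u hφ.memLp_v)) ∧
      (NLDirac.linOp g ω v u).IsEigenvector (2 * Complex.I * ω)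
        (WithLp.toLp 2 (NLDirac.spinor hφ.memLp_u hφ.memLp_v,
          -(Complex.I • NLDirac.spinor hφ.memLp_u hφ.memLp_v)))) := by
  have hgd : Differentiable ℝ g := hg.differentiable (by simp)
  have hg' : Continuous (deriv g) := hg.continuous_deriv (by exact_mod_cast le_top)
  obtain ⟨A, hA⟩ := hφ.exists_isAsymptoticPot_potMinus hgd.continuous hg0
  obtain ⟨B, hB⟩ := hφ.exists_isAsymptoticPot_potPlus hgd.continuous hg' hg0
  have hess : (NLDirac.linOp g ω v u).essentialSpectrum = {z : ℂ | z.re = 0 ∧ 1 - ω ≤ |z.im|} :=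
    NLDirac.essentialSpectrum_blockOp hω0 hω1 hA hB
  have hAs := hA.isGraphSelfAdjoint
  have hBs := hB.isGraphSelfAdjoint
  refine ⟨⟨hess, ?_⟩, hφ.nullSpace_linOp hgd hA hB, ?_, ?_⟩
  · rw [← hess]
    refine LinearPMap.continuousSpectrum_eq
      (NLDirac.isClosed_graph_blockOp hAs hBs) fun z hz hp => ?_
    rw [hess] at hz
    exact NLDirac.denseRange_blockOp hAs hBs hz.1 hp
  · have h := hφ.isEigenvector_linOp hA hB Complex.I_mul_I
    rwa [show -(2 * (ω : ℂ)) * Complex.I = -(2 * Complex.I * ω) by ring] at h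
  · have h := hφ.isEigenvector_linOp hA hB (c := -Complex.I) (by simp)
    rwa [neg_smul, show -(2 * (ω : ℂ)) * -Complex.I = 2 * Complex.I * ω by ring] at h
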